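/- Let $d\ge 1$ be an integer and let $r>1$. Call a sequence $(a_n)_{n\ge1}$ of positive integers lacunary with growth factor $r$ if $a_{n+1}\ge r\,a_n$ for all $n\ge 1$. For a Borel measure $\mu$ on $[0,1]^d$ write $(\mathcal F\mu)(\mathbf x)=\int e^{2\pi i\,\mathbf x\cdot\boldsymbol\xi}\,d\mu(\boldsymbol\xi)$, $\mathbf x\in\mathbb R^d$. A convex body is a non-empty compact convex subset of $\mathbb R^d$. For every $\Upsilon>0$ there is a constant $C>0$, depending only on $d$, $r$ and $\Upsilon$, with the following property. Let $(a_n)_{n\ge1}$ be a lacunary sequence of positive integers with growth factor $r$, and let $\mu$ be a Borel probability measure on $[0,1]^d$ such that, for some constant $A$, $|(\mathcal F\mu)(\mathbf x)|\le A\,(1+\|\mathbf x\|)^{-\Upsilon}$ for all $\mathbf x\in\mathbb R^d$. Then for $\mu$-almost every $\boldsymbol\alpha\in[0,1]^d$ there is an $N_0\in\mathbb N$ such that, for all $N\ge N_0$, every convex body $\mathcal C\subset[0,1]^d$ with $$\mathrm{Vol}(\mathcal C)\ \ge\ C\,\frac{(\log N)^2}{N}$$ contains at least one of the points $\boldsymbol\alpha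 a_1,\dots,\boldsymbol\alpha a_N$, reduced modulo $1$ in each coordinate to $[0,1)^d$. The case $\mu=$ Lebesgue measure is included: there is a constant $C>0$, depending only on $d$ and $r$, such that for every lacunary sequence of positive integers with growth factor $r$ the same conclusion holds for Lebesgue-almost every $\boldsymbol\alpha\in[0,1]^d$. -/

import Mathlib

open MeasureTheory

noncomputable section

/-- A lacunary sequence of (positive) integers `a 1, a 2, …` with growth factor `r`.
The value `a 0` plays no role. -/
structure IsLacunary (r : ℝ) (a : ℕ → ℤ) : Prop where
  pos : ∀ n : ℕ, 1 ≤ n → 0 < a n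
  gap : ∀ n : ℕ, 1 ≤ n → r * (a n : ℝ) ≤ (a (n + 1) : ℝ)

/-- The unit cube `[0,1]^d`. -/
def unitCube (d : ℕ) : Set (EuclideanSpace ℝ (Fin d)) :=
  {x | ∀ i, x i ∈ Set.Icc (0 : ℝ) 1}

/-- The Fourier transform of a measure, `∫ e(x · ξ) dμ(ξ)` with `e(t) = exp (2 π i t)`. -/
def measureFourier {d : ℕ} (μ : Measure (EuclideanSpace ℝ (Fin d)))
    (x : EuclideanSpace ℝ (Fin d)) : ℂ :=
  ∫ ξ, Complex.exp (2 * Real.pi * Complex.I * ((inner ℝ x ξ : ℝ) : ℂ)) ∂μ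

/-- The decay condition `|(ℱμ)(x)| ≪ (1 + ‖x‖)^(-Υ)`. -/
def HasFourierDecay {d : ℕ} (μ : Measure (EuclideanSpace ℝ (Fin d))) (Υ : ℝ) : Prop :=
  ∃ A : ℝ, ∀ x : EuclideanSpace ℝ (Fin d), ‖measureFourier μ x‖ ≤ A * (1 + ‖x‖) ^ (-Υ)

/-- The point `α m` modulo `1`, an element of `[0,1)^d`. -/
def dilateModOne {d : ℕ} (α : EuclideanSpace ℝ (Fin d)) (m : ℤ) : EuclideanSpace ℝ (Fin d) :=
  WithLp.toLp 2 fun i => Int.fract (α i * (m : ℝ))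

/-- For all sufficiently large `N`, every convex body in the unit cube of volume at least
`C (log N)^2 / N` contains one of the points `α a 1, …, α a N` modulo `1`. -/
def EventuallyHitsConvexBodies {d : ℕ} (C : ℝ) (a : ℕ → ℤ)
    (α : EuclideanSpace ℝ (Fin d)) : Prop :=
  ∃ N₀ : ℕ, ∀ N : ℕ, N₀ ≤ N →
    ∀ K : ConvexBody (EuclideanSpace ℝ (Fin d)),
      (K : Set (EuclideanSpace ℝ (Fin d))) ⊆ unitCube d →
      C * (Real.log N) ^ 2 / N ≤ volume.real (K : Set (EuclideanSpace ℝ (Fin d))) →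
      ∃ n : ℕ, 1 ≤ n ∧ n ≤ N ∧ dilateModOne α (a n) ∈ K

end

/-! Fix a scale `N`. A convex body `K` of the required volume contains, with room `N⁻³` to spare, a
set `P` cut out by `d` slabs with integer coefficients of size at most `N⁴`, and `vol P` is at least
`(16d)⁻ᵈ vol K` (`exists_slabSet`). So only polynomially many test sets matter, and a union bound is
available.

For one `P`, let `f` be its indicator smoothed by a product of cosine powers. It is a trigonometric
polynomial of degree `N⁷` with values in `[0,1]`, mean `vol P`, coefficients at most 1 in modulus,
and values at most `ε = N⁻²` at points of the cube outside `K`. If the dilates all miss `K`, every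
factor `1 + ε - f(α b_j)` is at least 1, so by Markov's inequality the probability is at most the
integral of their product (`measure_missEvent_le`).

The `b_j` form a subsequence of `a` with step `s ≍ log N`, so that consecutive ratios are at least a
large power `R` of `N`. In the expanded product the last nonzero frequency dominates all earlier
ones, and Fourier decay makes the product behave as if its factors were independent
(`norm_integral_prod_le_of_lacunary`). The integral is thus about `(1 + ε - vol P)^J` with `J ≍ N /
log N`, which is smaller than any prescribed power of `1/N` once `C` is large. One logarithm in the
volume pays for the thinning, the other for the union bound. Borel–Cantelli over `N` concludes; the
decay constant `A` only multiplies a summable series, so `C` does not depend on it. -/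

noncomputable section

/-! ### Characters and the one-dimensional cosine kernel. -/

/-- The additive character `e(t) = exp (2 π i t)`. -/
def expUnit (t : ℝ) : ℂ := Complex.exp (2 * Real.pi * Complex.I * (t : ℂ))

lemma expUnit_zero : expUnit 0 = 1 := by simp [expUnit]

lemma expUnit_add (s t : ℝ) : expUnit (s + t) = expUnit s * expUnit t := by
  simp only [expUnit, ← Complex.exp_add]; congr 1; push_cast; ring

lemma norm_expUnit (t : ℝ) : ‖expUnit t‖ = 1 := by
  have : (2 * Real.pi * Complex.I * (t : ℂ)) = ((2 * Real.pi * t : ℝ) : ℂ) * Complex.I := by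
    push_cast; ring
  rw [expUnit, this, Complex.norm_exp_ofReal_mul_I]

lemma continuous_expUnit : Continuous expUnit := by
  unfold expUnit; fun_prop

lemma expUnit_sum {ι : Type*} (s : Finset ι) (f : ι → ℝ) :
    expUnit (∑ i ∈ s, f i) = ∏ i ∈ s, expUnit (f i) := by
  classical
  induction s using Finset.induction_on with
  | empty => simp [expUnit_zero]
  | insert a s ha ih => rw [Finset.sum_insert ha, Finset.prod_insert ha, expUnit_add, ih]

lemma expUnit_nat_mul (n : ℕ) (t : ℝ) : expUnit (n * t) = expUnit t ^ n := by
  simp only [expUnit, ← Complex.exp_nat_mul]; congr 1; push_cast; ring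

/-- Both sides are the square of `e(t/2) + e(-t/2)`. This turns an even power of a cosine into a
binomial expansion in characters. -/
lemma expUnit_neg_half_mul (t : ℝ) : expUnit (-t) * (1 + expUnit t) ^ 2 = 4 * (Real.cos (Real.pi * t) : ℂ) ^ 2 := by
  have h1 : expUnit t = expUnit (t / 2) ^ 2 := by
    rw [pow_two, ← expUnit_add]; congr 1; ring
  have h2 : expUnit (-t) = expUnit (-(t / 2)) ^ 2 := by
    rw [pow_two, ← expUnit_add]; congr 1; ring
  have h3 : expUnit (-(t / 2)) * expUnit (t / 2) = 1 := by
    rw [← expUnit_add]; simp [expUnit_zero]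
  have h4 : (2 : ℂ) * (Real.cos (Real.pi * t) : ℂ) = expUnit (t / 2) + expUnit (-(t / 2)) := by
    rw [Complex.ofReal_cos, Complex.cos, expUnit, expUnit]
    have e1 : ((Real.pi * t : ℝ) : ℂ) * Complex.I = 2 * Real.pi * Complex.I * ((t / 2 : ℝ) : ℂ) := by
      push_cast; ring
    have e2 : -((Real.pi * t : ℝ) : ℂ) * Complex.I = 2 * Real.pi * Complex.I * ((-(t / 2) : ℝ) : ℂ) := by
      push_cast; ring
    rw [e1, e2]; ring
  have h5 : (4 : ℂ) * (Real.cos (Real.pi * t) : ℂ) ^ 2 = (2 * (Real.cos (Real.pi * t) : ℂ)) ^ 2 := by ring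
  rw [h5, h4, h1, h2]
  rw [← mul_pow]
  congr 1
  linear_combination (expUnit (t/2)) * h3

/-- Integral of a nontrivial character over the unit interval. -/
lemma integral_expUnit_int (k : ℤ) :
    ∫ y in (0:ℝ)..1, expUnit (-(k * y)) = if k = 0 then 1 else 0 := by
  split_ifs with h
  · simp [h, expUnit_zero]
  · have hc : (-(2 * Real.pi * Complex.I * k) : ℂ) ≠ 0 := by
      simp [h, Real.pi_ne_zero, Complex.I_ne_zero]
    have : ∀ y : ℝ, expUnit (-(k * y)) = Complex.exp (-(2 * Real.pi * Complex.I * k) * y) := by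
      intro y; unfold expUnit; congr 1; push_cast; ring
    simp_rw [this]
    rw [integral_exp_mul_complex hc]
    have h1 : Complex.exp (-(2 * Real.pi * Complex.I * k) * ((1:ℝ):ℂ)) = 1 := by
      rw [Complex.exp_eq_one_iff]; exact ⟨-k, by push_cast; ring⟩
    rw [h1]; simp

/-- A nonnegative trigonometric polynomial of degree `m` and mean one, concentrated near `ℤ`. -/
def cosKernel (m : ℕ) (t : ℝ) : ℝ :=
  4 ^ m / (Nat.centralBinom m : ℝ) * Real.cos (Real.pi * t) ^ (2 * m)

/-- The Fourier coefficients of `cosKernel m`. -/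
def cosKernelCoeff (m : ℕ) (k : ℤ) : ℝ :=
  ((2 * m).choose (k + m).toNat : ℝ) / (Nat.centralBinom m : ℝ)

lemma centralBinom_cast_pos (m : ℕ) : (0 : ℝ) < Nat.centralBinom m := by
  exact_mod_cast Nat.centralBinom_pos m

lemma cosKernelCoeff_zero (m : ℕ) : cosKernelCoeff m 0 = 1 := by
  unfold cosKernelCoeff
  rw [zero_add, Int.toNat_natCast, ← Nat.centralBinom_eq_two_mul_choose]
  exact div_self (centralBinom_cast_pos m).ne'

lemma cosKernelCoeff_nonneg (m : ℕ) (k : ℤ) : 0 ≤ cosKernelCoeff m k := by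
  unfold cosKernelCoeff; positivity

lemma cosKernelCoeff_le_one (m : ℕ) (k : ℤ) : cosKernelCoeff m k ≤ 1 := by
  unfold cosKernelCoeff
  rw [div_le_one (centralBinom_cast_pos m)]
  exact_mod_cast Nat.choose_le_centralBinom _ _

/-- Binomial theorem for `(1 + e(t))^(2m)`, recentred by `e(-t)^m`. The range `|k| ≤ m` matters: for
`k < -m`, `toNat` truncates to 0 and `cosKernelCoeff` is nonzero although the true coefficient
vanishes. -/
lemma cosKernel_eq_sum (m : ℕ) (t : ℝ) :
    (cosKernel m t : ℂ) = ∑ k ∈ Finset.Icc (-(m : ℤ)) m, (cosKernelCoeff m k : ℂ) * expUnit (k * t) := by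
  have h1 : ∑ k ∈ Finset.Icc (-(m : ℤ)) m, (cosKernelCoeff m k : ℂ) * expUnit (k * t)
      = ∑ j ∈ Finset.range (2 * m + 1), (((2 * m).choose j : ℝ) / (Nat.centralBinom m : ℝ) : ℝ) *
          expUnit (((j : ℤ) - m : ℤ) * t) := by
    symm
    refine Finset.sum_bij' (fun j _ => (j : ℤ) - m) (fun k _ => (k + m).toNat) ?_ ?_ ?_ ?_ ?_
    · intro j hj; simp at hj ⊢; omega
    · intro j hj; simp at hj ⊢; omega
    · intro j hj; simp
    · intro j hj; simp at hj ⊢; omega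
    · intro j hj; simp [cosKernelCoeff]
  rw [h1]
  have h2 : ∀ j : ℕ, expUnit (((j : ℤ) - m : ℤ) * t) = expUnit (-t) ^ m * expUnit t ^ j := by
    intro j
    rw [← expUnit_nat_mul, ← expUnit_nat_mul, ← expUnit_add]
    congr 1; push_cast; ring
  simp_rw [h2]
  have h3 := (Commute.all (expUnit t) 1).add_pow (2 * m)
  have h4 : expUnit (-t) ^ m * (expUnit t + 1) ^ (2 * m) = 4 ^ m * (Real.cos (Real.pi * t) : ℂ) ^ (2 * m) := by
    rw [pow_mul, ← mul_pow, add_comm (expUnit t), expUnit_neg_half_mul, mul_pow, ← pow_mul]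
  unfold cosKernel
  push_cast at h4 ⊢
  rw [div_mul_eq_mul_div, ← h4, h3, Finset.mul_sum, Finset.sum_div]
  refine Finset.sum_congr rfl fun j _ => ?_
  simp only [one_pow, mul_one]
  ring

lemma cosKernel_nonneg (m : ℕ) (t : ℝ) : 0 ≤ cosKernel m t := by
  unfold cosKernel
  have := Even.pow_nonneg (even_two_mul m) (Real.cos (Real.pi * t))
  positivity

lemma continuous_cosKernel (m : ℕ) : Continuous (cosKernel m) := by
  unfold cosKernel; fun_prop

lemma cosKernel_add_int (m : ℕ) (t : ℝ) (n : ℤ) : cosKernel m (t + n) = cosKernel m t := by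
  unfold cosKernel
  congr 1
  rw [mul_add, mul_comm Real.pi (n : ℝ), Real.cos_add_int_mul_pi, mul_pow, pow_mul ((-1 : ℝ) ^ n)]
  have : ((-1 : ℝ) ^ n) ^ 2 = 1 := by
    rcases Int.even_or_odd n with h | h
    · simp [h.neg_one_zpow]
    · simp [h.neg_one_zpow]
  simp [this]

lemma four_pow_div_centralBinom_le {m : ℕ} (hm : 1 ≤ m) : (4 : ℝ) ^ m / Nat.centralBinom m ≤ 2 * m := by
  rw [div_le_iff₀ (centralBinom_cast_pos m)]
  exact_mod_cast Nat.four_pow_le_two_mul_self_mul_centralBinom m hm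

lemma cosKernel_le {m : ℕ} (hm : 1 ≤ m) (t : ℝ) : cosKernel m t ≤ 2 * m := by
  unfold cosKernel
  have h1 : Real.cos (Real.pi * t) ^ (2 * m) ≤ 1 := by
    rw [pow_mul]; exact pow_le_one₀ (sq_nonneg _) (Real.cos_sq_le_one _)
  have := four_pow_div_centralBinom_le hm
  have h0 : (0 : ℝ) ≤ 4 ^ m / Nat.centralBinom m := by positivity
  nlinarith

/-- Jordan's inequality, reflected about `1/2`, gives `sin² πt ≥ 4δ²`, hence `cos² πt ≤ exp(-4δ²)`.
The normalising constant costs only the factor `2m`. -/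
lemma cosKernel_le_of_far {m : ℕ} (hm : 1 ≤ m) {δ t : ℝ} (hδ : 0 ≤ δ) (h1 : δ ≤ |t|) (h2 : |t| ≤ 1 - δ) :
    cosKernel m t ≤ 2 * m * Real.exp (-(4 * δ ^ 2 * m)) := by
  have hsin : ∀ s : ℝ, 0 ≤ s → s ≤ 1 / 2 → 2 * s ≤ Real.sin (Real.pi * s) := by
    intro s hs hs2
    have := Real.mul_le_sin (x := Real.pi * s) (by positivity) (by nlinarith [Real.pi_pos])
    calc 2 * s = 2 / Real.pi * (Real.pi * s) := by field_simp
      _ ≤ _ := this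
  have hsq : 4 * δ ^ 2 ≤ Real.sin (Real.pi * t) ^ 2 := by
    have habs : Real.sin (Real.pi * t) ^ 2 = Real.sin (Real.pi * |t|) ^ 2 := by
      rcases abs_cases t with ⟨h, _⟩ | ⟨h, _⟩ <;> rw [h]
      rw [mul_neg, Real.sin_neg, neg_sq]
    rw [habs]
    have : 2 * δ ≤ Real.sin (Real.pi * |t|) := by
      rcases le_total |t| (1 / 2) with h | h
      · exact le_trans (by linarith) (hsin |t| (abs_nonneg _) h)
      · have h3 := hsin (1 - |t|) (by linarith) (by linarith)
        have : Real.pi * (1 - |t|) = Real.pi - Real.pi * |t| := by ring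
        rw [this, Real.sin_pi_sub] at h3
        linarith
    nlinarith
  have hcos : Real.cos (Real.pi * t) ^ (2 * m) ≤ Real.exp (-(4 * δ ^ 2 * m)) := by
    rw [pow_mul]
    have h3 : Real.cos (Real.pi * t) ^ 2 ≤ Real.exp (-(4 * δ ^ 2)) := by
      rw [Real.cos_sq']
      have := Real.add_one_le_exp (-(4 * δ ^ 2))
      linarith
    calc _ ≤ Real.exp (-(4 * δ ^ 2)) ^ m := pow_le_pow_left₀ (sq_nonneg _) h3 m
      _ = _ := by rw [← Real.exp_nat_mul]; congr 1; ring
  unfold cosKernel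
  exact mul_le_mul (four_pow_div_centralBinom_le hm) hcos
    (Even.pow_nonneg (even_two_mul m) _) (by positivity)

lemma integral_cosKernel_sub (m : ℕ) (x : ℝ) : ∫ y in (0:ℝ)..1, cosKernel m (x - y) = 1 := by
  have h : ((∫ y in (0:ℝ)..1, cosKernel m (x - y) : ℝ) : ℂ) = 1 := by
    rw [← intervalIntegral.integral_ofReal]
    simp_rw [cosKernel_eq_sum]
    rw [intervalIntegral.integral_finsetSum]
    · have : ∀ k ∈ Finset.Icc (-(m : ℤ)) m, ∫ y in (0:ℝ)..1, (cosKernelCoeff m k : ℂ) * expUnit (k * (x - y))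
          = if k = 0 then 1 else 0 := by
        intro k _
        have e : ∀ y : ℝ, (cosKernelCoeff m k : ℂ) * expUnit (k * (x - y))
            = ((cosKernelCoeff m k : ℂ) * expUnit (k * x)) * expUnit (-(k * y)) := by
          intro y; rw [mul_assoc, ← expUnit_add]; congr 2; ring
        simp_rw [e]
        rw [intervalIntegral.integral_const_mul, integral_expUnit_int]
        split_ifs with h
        · simp [h, cosKernelCoeff_zero, expUnit_zero]
        · simp
      rw [Finset.sum_congr rfl this]
      simp
    · intro k _
      apply Continuous.intervalIntegrable
      have := continuous_expUnit
      fun_prop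
  exact_mod_cast h

/-! ### Smoothed indicators on the torus. -/

/-- The pairing of a frequency in `ℤ^d` with a point of `ℝ^d`. -/
def phase {d : ℕ} (k : Fin d → ℤ) (x : Fin d → ℝ) : ℝ := ∑ i, (k i : ℝ) * x i

/-- Frequencies with all coordinates of size at most `m`. -/
def freqBox (d m : ℕ) : Finset (Fin d → ℤ) :=
  Fintype.piFinset fun _ => Finset.Icc (-(m : ℤ)) m

lemma mem_freqBox {d m : ℕ} {k : Fin d → ℤ} : k ∈ freqBox d m ↔ ∀ i, |k i| ≤ m := by
  simp [freqBox, abs_le]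

lemma card_freqBox (d m : ℕ) : (freqBox d m).card = (2 * m + 1) ^ d := by
  rw [freqBox, Fintype.card_piFinset_const, Int.card_Icc]
  congr 1
  omega

lemma continuous_phase {d : ℕ} (k : Fin d → ℤ) : Continuous (phase k) := by
  unfold phase; fun_prop

lemma phase_sub {d : ℕ} (k : Fin d → ℤ) (x y : Fin d → ℝ) :
    phase k (fun i => x i - y i) = phase k x + -phase k y := by
  simp only [phase, mul_sub, Finset.sum_sub_distrib]; ring

lemma phase_zero_left {d : ℕ} (x : Fin d → ℝ) : phase 0 x = 0 := by simp [phase]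

lemma prod_cosKernel_eq_sum {d : ℕ} (m : ℕ) (x : Fin d → ℝ) :
    ((∏ i, cosKernel m (x i) : ℝ) : ℂ) =
      ∑ k ∈ freqBox d m, ((∏ i, cosKernelCoeff m (k i) : ℝ) : ℂ) * expUnit (phase k x) := by
  push_cast
  simp_rw [cosKernel_eq_sum]
  rw [Finset.prod_univ_sum]
  refine Finset.sum_congr rfl fun k _ => ?_
  rw [Finset.prod_mul_distrib, phase, expUnit_sum]

/-- The closed unit cube as a subset of `Fin d → ℝ`. -/
def piCube (d : ℕ) : Set (Fin d → ℝ) := Set.Icc 0 1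

lemma piCube_eq_pi (d : ℕ) : piCube d = Set.univ.pi fun _ => Set.Icc (0 : ℝ) 1 := by
  rw [Set.pi_univ_Icc]; rfl

lemma isCompact_piCube (d : ℕ) : IsCompact (piCube d) := isCompact_Icc

lemma volume_piCube (d : ℕ) : volume (piCube d) = 1 := by
  rw [piCube, Real.volume_Icc_pi]; simp

/-- The indicator of `P` convolved with the product kernel. -/
def smoothIndicator {d : ℕ} (P : Set (Fin d → ℝ)) (m : ℕ) (x : Fin d → ℝ) : ℝ :=
  ∫ y in P, ∏ i, cosKernel m (x i - y i)

/-- The Fourier coefficients of `smoothIndicator P m`. -/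
def smoothCoeff {d : ℕ} (P : Set (Fin d → ℝ)) (m : ℕ) (k : Fin d → ℤ) : ℂ :=
  ((∏ i, cosKernelCoeff m (k i) : ℝ) : ℂ) * ∫ y in P, expUnit (-phase k y)

lemma integrableOn_of_continuous_of_subset_piCube {d : ℕ} {F : Type*} [NormedAddCommGroup F]
    {P : Set (Fin d → ℝ)} (hP : P ⊆ piCube d) {f : (Fin d → ℝ) → F} (hf : Continuous f) :
    IntegrableOn f P volume :=
  (hf.continuousOn.integrableOn_compact (isCompact_piCube d)).mono_set hP

lemma volume_ne_top_of_subset_piCube {d : ℕ} {P : Set (Fin d → ℝ)} (hP : P ⊆ piCube d) :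
    volume P ≠ ⊤ :=
  ne_top_of_le_ne_top (by rw [volume_piCube]; exact ENNReal.one_ne_top) (measure_mono hP)

lemma volume_real_le_one {d : ℕ} {P : Set (Fin d → ℝ)} (hP : P ⊆ piCube d) :
    volume.real P ≤ 1 := by
  have h := measureReal_mono (μ := volume) hP (by rw [volume_piCube]; exact ENNReal.one_ne_top)
  rwa [measureReal_def (s := piCube d), volume_piCube, ENNReal.toReal_one] at h

lemma continuous_prod_cosKernel {d : ℕ} (m : ℕ) (x : Fin d → ℝ) :
    Continuous fun y : Fin d → ℝ => ∏ i, cosKernel m (x i - y i) := by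
  have := continuous_cosKernel m
  fun_prop

lemma smoothIndicator_eq_sum {d : ℕ} {P : Set (Fin d → ℝ)} (hP : P ⊆ piCube d) (m : ℕ)
    (x : Fin d → ℝ) :
    (smoothIndicator P m x : ℂ) = ∑ k ∈ freqBox d m, smoothCoeff P m k * expUnit (phase k x) := by
  have hc := continuous_expUnit
  unfold smoothIndicator
  rw [← integral_complex_ofReal]
  have h : ∀ y : Fin d → ℝ, ((∏ i, cosKernel m (x i - y i) : ℝ) : ℂ) =
      ∑ k ∈ freqBox d m, ((∏ i, cosKernelCoeff m (k i) : ℝ) : ℂ) * expUnit (phase k x) *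
        expUnit (-phase k y) := by
    intro y
    rw [prod_cosKernel_eq_sum m fun i => x i - y i]
    simp_rw [phase_sub, expUnit_add, mul_assoc]
  simp_rw [h]
  rw [integral_finsetSum]
  · refine Finset.sum_congr rfl fun k _ => ?_
    rw [integral_const_mul, smoothCoeff]; ring
  · intro k _
    have := continuous_phase k
    exact integrableOn_of_continuous_of_subset_piCube hP (by fun_prop)

lemma norm_smoothCoeff_le {d : ℕ} {P : Set (Fin d → ℝ)} (hP : P ⊆ piCube d) (m : ℕ)
    (k : Fin d → ℤ) : ‖smoothCoeff P m k‖ ≤ 1 := by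
  rw [smoothCoeff, norm_mul, Complex.norm_real, Real.norm_eq_abs, abs_of_nonneg
    (Finset.prod_nonneg fun i _ => cosKernelCoeff_nonneg m (k i))]
  refine mul_le_one₀ (Finset.prod_le_one (fun i _ => cosKernelCoeff_nonneg m (k i))
    (fun i _ => cosKernelCoeff_le_one m (k i))) (norm_nonneg _) ?_
  refine (norm_setIntegral_le_of_norm_le_const (C := 1)
    (volume_ne_top_of_subset_piCube hP).lt_top (fun y _ => (norm_expUnit _).le)).trans ?_
  rw [one_mul]; exact volume_real_le_one hP

lemma smoothCoeff_zero {d : ℕ} (P : Set (Fin d → ℝ)) (m : ℕ) :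
    smoothCoeff P m 0 = (volume.real P : ℂ) := by
  simp [smoothCoeff, cosKernelCoeff_zero, phase_zero_left, expUnit_zero]

lemma continuous_smoothIndicator {d : ℕ} {P : Set (Fin d → ℝ)} (hP : P ⊆ piCube d) (m : ℕ) :
    Continuous (smoothIndicator P m) := by
  have : smoothIndicator P m = fun x =>
      (∑ k ∈ freqBox d m, smoothCoeff P m k * expUnit (phase k x)).re := by
    ext x; rw [← smoothIndicator_eq_sum hP, Complex.ofReal_re]
  rw [this]
  have hc := continuous_expUnit
  refine Complex.continuous_re.comp (continuous_finsetSum _ fun k _ => ?_)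
  have := continuous_phase k
  fun_prop

lemma smoothIndicator_nonneg {d : ℕ} (P : Set (Fin d → ℝ)) (m : ℕ) (x : Fin d → ℝ) :
    0 ≤ smoothIndicator P m x :=
  integral_nonneg fun _ => Finset.prod_nonneg fun _ _ => cosKernel_nonneg _ _

lemma smoothIndicator_add_int {d : ℕ} (P : Set (Fin d → ℝ)) (m : ℕ) (x : Fin d → ℝ)
    (n : Fin d → ℤ) : smoothIndicator P m (fun i => x i + n i) = smoothIndicator P m x := by
  unfold smoothIndicator
  congr 1; ext y
  refine Finset.prod_congr rfl fun i _ => ?_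
  rw [add_sub_right_comm, cosKernel_add_int]

lemma setIntegral_piCube_prod {d : ℕ} {𝕜 : Type*} [RCLike 𝕜] (f : Fin d → ℝ → 𝕜) :
    ∫ y in piCube d, ∏ i, f i (y i) = ∏ i, ∫ t in (0:ℝ)..1, f i t := by
  rw [piCube_eq_pi, volume_pi, Measure.restrict_pi_pi, integral_fintype_prod_eq_prod]
  refine Finset.prod_congr rfl fun i _ => ?_
  rw [intervalIntegral.integral_of_le zero_le_one, integral_Icc_eq_integral_Ioc]

/-- The kernel is nonnegative, so enlarging `P` to the whole cube only increases the integral, which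
then equals 1. -/
lemma smoothIndicator_le_one {d : ℕ} {P : Set (Fin d → ℝ)} (hP : P ⊆ piCube d) (m : ℕ)
    (x : Fin d → ℝ) : smoothIndicator P m x ≤ 1 := by
  have h : smoothIndicator P m x ≤ smoothIndicator (piCube d) m x :=
    setIntegral_mono_set (integrableOn_of_continuous_of_subset_piCube subset_rfl
      (continuous_prod_cosKernel m x))
      (Filter.Eventually.of_forall fun _ => Finset.prod_nonneg fun _ _ => cosKernel_nonneg _ _)
      (Filter.Eventually.of_forall hP)
  refine h.trans ?_
  rw [smoothIndicator, setIntegral_piCube_prod fun i t => cosKernel m (x i - t)]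
  exact (Finset.prod_eq_one fun i _ => integral_cosKernel_sub m (x i)).le

lemma smoothIndicator_le_of_far {d : ℕ} {P : Set (Fin d → ℝ)}
    (hP : P ⊆ piCube d) {m : ℕ} (hm : 1 ≤ m) {δ : ℝ} (hδ : 0 ≤ δ) {x : Fin d → ℝ}
    (hfar : ∀ y ∈ P, ∃ i, δ ≤ |x i - y i| ∧ |x i - y i| ≤ 1 - δ) :
    smoothIndicator P m x ≤ (2 * m) ^ d * Real.exp (-(4 * δ ^ 2 * m)) := by
  have hb : ∀ y ∈ P, ‖∏ i, cosKernel m (x i - y i)‖ ≤ (2 * m) ^ d * Real.exp (-(4 * δ ^ 2 * m)) := by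
    intro y hy
    obtain ⟨i, h1, h2⟩ := hfar y hy
    rw [Real.norm_eq_abs, abs_of_nonneg (Finset.prod_nonneg fun _ _ => cosKernel_nonneg _ _),
      ← Finset.mul_prod_erase _ _ (Finset.mem_univ i)]
    have hd : d = (d - 1) + 1 := by have := i.pos; omega
    calc cosKernel m (x i - y i) * ∏ j ∈ Finset.univ.erase i, cosKernel m (x j - y j)
        ≤ (2 * m * Real.exp (-(4 * δ ^ 2 * m))) * ∏ j ∈ Finset.univ.erase i, (2 * m : ℝ) := by
          refine mul_le_mul (cosKernel_le_of_far hm hδ h1 h2) ?_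
            (Finset.prod_nonneg fun _ _ => cosKernel_nonneg _ _) (by positivity)
          exact Finset.prod_le_prod (fun _ _ => cosKernel_nonneg _ _) fun _ _ => cosKernel_le hm _
      _ = (2 * m) ^ d * Real.exp (-(4 * δ ^ 2 * m)) := by
          rw [Finset.prod_const, Finset.card_erase_of_mem (Finset.mem_univ i), Finset.card_univ,
            Fintype.card_fin]
          conv_rhs => rw [hd, pow_succ]
          ring
  refine (le_abs_self _).trans ?_
  rw [← Real.norm_eq_abs]
  refine (norm_setIntegral_le_of_norm_le_const (volume_ne_top_of_subset_piCube hP).lt_top hb).trans ?_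
  exact mul_le_of_le_one_right (by positivity) (volume_real_le_one hP)

/-! ### Moments of lacunary products of trigonometric polynomials. -/

/-- The trigonometric polynomial with frequencies in `freqBox d D` and coefficients `c`. -/
def trigEval {d : ℕ} (D : ℕ) (c : (Fin d → ℤ) → ℂ) (x : Fin d → ℝ) : ℂ :=
  ∑ k ∈ freqBox d D, c k * expUnit (phase k x)

/-- The sum of the absolute values of the coefficients. -/
def coeffNorm {d : ℕ} (D : ℕ) (c : (Fin d → ℤ) → ℂ) : ℝ := ∑ k ∈ freqBox d D, ‖c k‖

lemma coeffNorm_nonneg {d : ℕ} (D : ℕ) (c : (Fin d → ℤ) → ℂ) : 0 ≤ coeffNorm D c :=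
  Finset.sum_nonneg fun _ _ => norm_nonneg _

lemma norm_trigEval_le {d : ℕ} (D : ℕ) (c : (Fin d → ℤ) → ℂ) (x : Fin d → ℝ) :
    ‖trigEval D c x‖ ≤ coeffNorm D c := by
  refine (norm_sum_le _ _).trans (Finset.sum_le_sum fun k _ => ?_)
  rw [norm_mul, norm_expUnit, mul_one]

lemma continuous_trigEval {d : ℕ} (D : ℕ) (c : (Fin d → ℤ) → ℂ) : Continuous (trigEval D c) := by
  unfold trigEval
  have hc := continuous_expUnit
  refine continuous_finsetSum _ fun k _ => ?_
  have := continuous_phase k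
  fun_prop

lemma phase_smul {d : ℕ} (b : ℤ) (k : Fin d → ℤ) (x : Fin d → ℝ) :
    phase k (fun i => x i * b) = phase (b • k) x := by
  simp only [phase, Pi.smul_apply, smul_eq_mul, Int.cast_mul]
  exact Finset.sum_congr rfl fun i _ => by ring

lemma phase_add_left {d : ℕ} (h k : Fin d → ℤ) (x : Fin d → ℝ) :
    phase (h + k) x = phase h x + phase k x := by
  simp [phase, add_mul, Finset.sum_add_distrib]

/-- A product of dilates of a trigonometric polynomial, twisted by a character. -/
def twistedProd {d : ℕ} (D : ℕ) (c : (Fin d → ℤ) → ℂ) (b : ℕ → ℤ) (J : ℕ) (h : Fin d → ℤ)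
    (x : Fin d → ℝ) : ℂ :=
  expUnit (phase h x) * ∏ j ∈ Finset.range J, trigEval D c fun i => x i * b j

/-- Expanding the last factor only shifts the twist, so the twisted products are closed under
peeling off factors; this drives both inductions below. -/
lemma twistedProd_succ {d : ℕ} (D : ℕ) (c : (Fin d → ℤ) → ℂ) (b : ℕ → ℤ) (J : ℕ)
    (h : Fin d → ℤ) (x : Fin d → ℝ) :
    twistedProd D c b (J + 1) h x =
      ∑ k ∈ freqBox d D, c k * twistedProd D c b J (h + b J • k) x := by
  unfold twistedProd
  rw [Finset.prod_range_succ]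
  conv_lhs => rw [trigEval.eq_1 D c fun i => x i * b J]
  rw [Finset.mul_sum, Finset.mul_sum]
  refine Finset.sum_congr rfl fun k _ => ?_
  rw [phase_smul, phase_add_left, expUnit_add]; ring

section Moment

variable {Ω : Type*} [MeasurableSpace Ω] {μ : Measure Ω} [IsProbabilityMeasure μ]
  {d : ℕ} {X : Ω → Fin d → ℝ}

lemma continuous_twistedProd (D : ℕ) (c : (Fin d → ℤ) → ℂ) (b : ℕ → ℤ) (J : ℕ)
    (h : Fin d → ℤ) : Continuous (twistedProd D c b J h) := by
  unfold twistedProd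
  have h1 := continuous_expUnit
  have h2 := continuous_phase h
  have h3 := continuous_trigEval D c
  fun_prop

lemma integrable_twistedProd (hX : Measurable X) (D : ℕ) (c : (Fin d → ℤ) → ℂ) (b : ℕ → ℤ)
    (J : ℕ) (h : Fin d → ℤ) : Integrable (fun ω => twistedProd D c b J h (X ω)) μ := by
  refine Integrable.of_bound (C := coeffNorm D c ^ J)
    ((continuous_twistedProd D c b J h).measurable.comp hX).aestronglyMeasurable
    (Filter.Eventually.of_forall fun ω => ?_)
  rw [twistedProd, norm_mul, norm_expUnit, one_mul, norm_prod]
  refine (Finset.prod_le_prod (fun _ _ => norm_nonneg _)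
    fun _ _ => norm_trigEval_le D c _).trans ?_
  simp

lemma integral_twistedProd_succ (hX : Measurable X) (D : ℕ) (c : (Fin d → ℤ) → ℂ) (b : ℕ → ℤ)
    (J : ℕ) (h : Fin d → ℤ) :
    ∫ ω, twistedProd D c b (J + 1) h (X ω) ∂μ =
      ∑ k ∈ freqBox d D, c k * ∫ ω, twistedProd D c b J (h + b J • k) (X ω) ∂μ := by
  simp_rw [twistedProd_succ]
  rw [integral_finsetSum _ fun k _ => (integrable_twistedProd hX D c b J _).const_mul _]
  simp_rw [integral_const_mul]

/-- Decay of the characteristic function of `X` along integer frequencies. -/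
def HasIntFourierDecay (μ : Measure Ω) (X : Ω → Fin d → ℝ) (A Υ : ℝ) : Prop :=
  ∀ (k : Fin d → ℤ) (T : ℝ), 0 ≤ T → (∃ i, T ≤ |(k i : ℝ)|) →
    ‖∫ ω, expUnit (phase k (X ω)) ∂μ‖ ≤ A * (1 + T) ^ (-Υ)

/-- In some coordinate the twist exceeds by `T` anything the frequencies of the product can cancel,
so every character in the expansion has a coordinate of size at least `T`. -/
lemma norm_integral_twistedProd_le (hX : Measurable X) {A Υ : ℝ}
    (hdec : HasIntFourierDecay μ X A Υ) (D : ℕ) (c : (Fin d → ℤ) → ℂ) (b : ℕ → ℤ) {T : ℝ}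
    (hT : 0 ≤ T) (J : ℕ) (h : Fin d → ℤ)
    (hh : ∃ i, T + D * ∑ j ∈ Finset.range J, |(b j : ℝ)| ≤ |(h i : ℝ)|) :
    ‖∫ ω, twistedProd D c b J h (X ω) ∂μ‖ ≤ coeffNorm D c ^ J * (A * (1 + T) ^ (-Υ)) := by
  induction J generalizing h with
  | zero => simpa [twistedProd] using hdec h T hT (by simpa using hh)
  | succ J ih =>
    rw [integral_twistedProd_succ hX]
    have hk : ∀ k ∈ freqBox d D, ‖c k * ∫ ω, twistedProd D c b J (h + b J • k) (X ω) ∂μ‖ ≤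
        ‖c k‖ * (coeffNorm D c ^ J * (A * (1 + T) ^ (-Υ))) := by
      intro k hk
      rw [norm_mul]
      refine mul_le_mul_of_nonneg_left (ih _ ?_) (norm_nonneg _)
      obtain ⟨i, hi⟩ := hh
      refine ⟨i, ?_⟩
      rw [Finset.sum_range_succ, mul_add] at hi
      have hki : |(k i : ℝ)| ≤ D := by exact_mod_cast mem_freqBox.1 hk i
      have h1 : |(b J : ℝ) * k i| ≤ D * |(b J : ℝ)| := by
        rw [abs_mul, mul_comm]; exact mul_le_mul_of_nonneg_right hki (abs_nonneg _)
      have h2 : |(h i : ℝ)| ≤ |(h i : ℝ) + b J * k i| + |(b J : ℝ) * k i| := by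
        have := abs_sub (( h i : ℝ) + b J * k i) (b J * k i)
        simpa using this
      simp only [Pi.add_apply, Pi.smul_apply, smul_eq_mul, Int.cast_add, Int.cast_mul]
      linarith
    refine (norm_sum_le_of_le _ hk).trans_eq ?_
    rw [← Finset.sum_mul, coeffNorm, pow_succ]; ring

/-- Peel off the last factor. Its constant term multiplies the shorter product by `c 0`; a nonzero
frequency `k` leaves the twist `b J • k`, which outweighs all earlier dilates and is handled by
decay. Since `‖c 0‖ ≤ 1`, earlier errors do not grow. -/
lemma norm_integral_prod_le (hX : Measurable X) {A Υ : ℝ}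
    (hdec : HasIntFourierDecay μ X A Υ) (D : ℕ) (c : (Fin d → ℤ) → ℂ) (hc : ‖c 0‖ ≤ 1)
    (b : ℕ → ℤ) (T : ℕ → ℝ) (hT : ∀ j, 0 ≤ T j)
    (hTb : ∀ j, T j + D * ∑ i ∈ Finset.range j, |(b i : ℝ)| ≤ |(b j : ℝ)|) (J : ℕ) (hA : 0 ≤ A) :
    ‖∫ ω, ∏ j ∈ Finset.range J, trigEval D c (fun i => X ω i * b j) ∂μ‖ ≤
      ‖c 0‖ ^ J + ∑ j ∈ Finset.range J, coeffNorm D c ^ (j + 1) * (A * (1 + T j) ^ (-Υ)) := by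
  have key : ∀ J, ‖∫ ω, twistedProd D c b J 0 (X ω) ∂μ‖ ≤
      ‖c 0‖ ^ J + ∑ j ∈ Finset.range J, coeffNorm D c ^ (j + 1) * (A * (1 + T j) ^ (-Υ)) := by
    intro J
    induction J with
    | zero => simp [twistedProd, phase_zero_left, expUnit_zero]
    | succ J ih =>
      have h0 : (0 : Fin d → ℤ) ∈ freqBox d D := by simp [mem_freqBox]
      rw [integral_twistedProd_succ hX, ← Finset.add_sum_erase _ _ h0, Finset.sum_range_succ,
        smul_zero, add_zero]
      set B := coeffNorm D c ^ J * (A * (1 + T J) ^ (-Υ))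
      have hB : 0 ≤ B := by
        have := coeffNorm_nonneg D c
        have := hT J
        positivity
      have hk : ∀ k ∈ (freqBox d D).erase 0,
          ‖c k * ∫ ω, twistedProd D c b J (0 + b J • k) (X ω) ∂μ‖ ≤ ‖c k‖ * B := by
        intro k hk
        rw [norm_mul]
        refine mul_le_mul_of_nonneg_left
          (norm_integral_twistedProd_le hX hdec D c b (hT J) J _ ?_) (norm_nonneg _)
        obtain ⟨i, hi⟩ := Function.ne_iff.1 (Finset.ne_of_mem_erase hk)
        refine ⟨i, (hTb J).trans ?_⟩
        simp only [Pi.add_apply, Pi.smul_apply, Pi.zero_apply, zero_add, smul_eq_mul, Int.cast_mul,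
          abs_mul]
        refine le_mul_of_one_le_right (abs_nonneg _) ?_
        exact_mod_cast Int.one_le_abs hi
      have h1 := norm_sum_le_of_le _ hk
      rw [← Finset.sum_mul] at h1
      have h2 : ∑ k ∈ (freqBox d D).erase 0, ‖c k‖ ≤ coeffNorm D c :=
        Finset.sum_le_sum_of_subset_of_nonneg (Finset.erase_subset _ _) fun _ _ _ => norm_nonneg _
      have h3 : ‖c 0 * ∫ ω, twistedProd D c b J 0 (X ω) ∂μ‖ ≤ ‖c 0‖ ^ (J + 1) +
          ∑ j ∈ Finset.range J, coeffNorm D c ^ (j + 1) * (A * (1 + T j) ^ (-Υ)) := by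
        have hS : 0 ≤ ∑ j ∈ Finset.range J, coeffNorm D c ^ (j + 1) * (A * (1 + T j) ^ (-Υ)) :=
          Finset.sum_nonneg fun j _ => by
            have := coeffNorm_nonneg D c
            have := hT j
            positivity
        rw [norm_mul]
        refine (mul_le_mul_of_nonneg_left ih (norm_nonneg _)).trans ?_
        rw [mul_add, pow_succ']
        gcongr
        exact mul_le_of_le_one_left hS hc
      refine (norm_add_le _ _).trans ?_
      have h4 := mul_le_mul_of_nonneg_right h2 hB
      have h5 : coeffNorm D c * B = coeffNorm D c ^ (J + 1) * (A * (1 + T J) ^ (-Υ)) := by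
        rw [pow_succ']; ring
      linarith
  simpa [twistedProd, phase_zero_left, expUnit_zero] using key J

/-- Moment bound for a product of dilates along a rapidly growing sequence. -/
lemma norm_integral_prod_le_of_lacunary (hX : Measurable X) {A Υ : ℝ} (hA : 0 ≤ A) (hΥ : 0 < Υ)
    (hdec : HasIntFourierDecay μ X A Υ) {D : ℕ} (hD : 1 ≤ D) (c : (Fin d → ℤ) → ℂ)
    (hc : ‖c 0‖ ≤ 1) {b : ℕ → ℤ} {R L : ℝ} (hR : 4 * D ≤ R) (hb0 : R ≤ b 0)
    (hb : ∀ j, R * b j ≤ b (j + 1)) (hL : coeffNorm D c ≤ L) (hLR : L * R ^ (-Υ) ≤ 1 / 2)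
    (J : ℕ) :
    ‖∫ ω, ∏ j ∈ Finset.range J, trigEval D c (fun i => X ω i * b j) ∂μ‖ ≤
      ‖c 0‖ ^ J + 2 ^ (1 + Υ) * A * (L * R ^ (-Υ)) := by
  have hD' : (1 : ℝ) ≤ D := by exact_mod_cast hD
  have hRpos : 0 < R := by linarith
  have hbpow : ∀ j, R ^ (j + 1) ≤ b j := by
    intro j
    induction j with
    | zero => simpa using hb0
    | succ j ih => rw [pow_succ']; exact (mul_le_mul_of_nonneg_left ih hRpos.le).trans (hb j)
  have hbpos : ∀ j, (0 : ℝ) < b j := fun j => (pow_pos hRpos _).trans_le (hbpow j)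
  -- The earlier dilates use at most half of `b j`, which allows the choice `T j = b j / 2`.
  have hsum : ∀ j, 2 * D * ∑ i ∈ Finset.range j, |(b i : ℝ)| ≤ b j := by
    intro j
    induction j with
    | zero => simpa using (hbpos 0).le
    | succ j ih =>
      rw [Finset.sum_range_succ, mul_add, abs_of_pos (hbpos j)]
      have := hb j
      nlinarith [hbpos j, mul_le_mul_of_nonneg_right hR (hbpos j).le]
  have h := norm_integral_prod_le hX hdec D c hc b (fun j => (b j : ℝ) / 2)
    (fun j => (half_pos (hbpos j)).le)
    (fun j => by rw [abs_of_pos (hbpos j)]; have := hsum j; linarith) J hA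
  refine h.trans (add_le_add_right ?_ _)
  set η := L * R ^ (-Υ)
  have hL0 : 0 ≤ L := (coeffNorm_nonneg D c).trans hL
  have hη : 0 ≤ η := by positivity
  -- Since `b j ≥ R^(j+1)`, the growth `L^(j+1)` is absorbed: the `j`-th error is at most a constant
  -- times `η^(j+1) ≤ η 2^(-j)`.
  have hterm : ∀ j ∈ Finset.range J, coeffNorm D c ^ (j + 1) * (A * (1 + (b j : ℝ) / 2) ^ (-Υ)) ≤
      2 ^ Υ * A * η * (1 / 2) ^ j := by
    intro j _
    have h1 : (1 + (b j : ℝ) / 2) ^ (-Υ) ≤ 2 ^ Υ * (R ^ (-Υ)) ^ (j + 1) := by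
      calc (1 + (b j : ℝ) / 2) ^ (-Υ) ≤ (R ^ (j + 1) / 2) ^ (-Υ) :=
            Real.rpow_le_rpow_of_nonpos (by positivity) (by linarith [hbpow j]) (by linarith)
        _ = 2 ^ Υ * (R ^ (-Υ)) ^ (j + 1) := by
            rw [Real.div_rpow (by positivity) (by norm_num), Real.rpow_neg (by norm_num : (0:ℝ) ≤ 2),
              div_inv_eq_mul, mul_comm, ← Real.rpow_natCast, ← Real.rpow_natCast,
              ← Real.rpow_mul hRpos.le, ← Real.rpow_mul hRpos.le, mul_comm (-Υ)]
    calc coeffNorm D c ^ (j + 1) * (A * (1 + (b j : ℝ) / 2) ^ (-Υ))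
        ≤ L ^ (j + 1) * (A * (2 ^ Υ * (R ^ (-Υ)) ^ (j + 1))) := by
          have := coeffNorm_nonneg D c
          have := hbpos j
          gcongr
      _ = 2 ^ Υ * A * η * η ^ j := by
          have : η ^ (j+1) = L ^ (j+1) * (R ^ (-Υ)) ^ (j + 1) := by rw [← mul_pow]
          rw [mul_assoc, ← pow_succ', this]; ring
      _ ≤ _ := by gcongr
  refine (Finset.sum_le_sum hterm).trans ?_
  rw [← Finset.mul_sum]
  have hgeo : ∑ j ∈ Finset.range J, (1 / 2 : ℝ) ^ j ≤ 2 := by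
    have := (summable_geometric_two).sum_le_tsum (Finset.range J) (fun _ _ => by positivity)
    rwa [tsum_geometric_two] at this
  calc _ ≤ 2 ^ Υ * A * η * 2 := by gcongr
    _ = _ := by rw [Real.rpow_add (by norm_num), Real.rpow_one]; ring

end Moment

/-! ### Convex bodies, inscribed simplices and slab sets. -/

section Geometry

variable {d : ℕ}

lemma volume_real_parallelepiped (o : Fin d → ℝ) (M : Matrix (Fin d) (Fin d) ℝ) {a b : ℝ}
    (hab : a ≤ b) :
    volume.real ((fun s => o + M.transpose.mulVec s) '' Set.Icc (fun _ => a) fun _ => b) =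
      |M.det| * (b - a) ^ d := by
  have h1 : (fun s => o + M.transpose.mulVec s) '' Set.Icc (fun _ => a) (fun _ => b) =
      (fun x => o + x) '' (Matrix.toLin' M.transpose '' Set.Icc (fun _ => a) fun _ => b) := by
    rw [Set.image_image]; simp
  rw [h1, measureReal_def, Set.image_add_left, measure_preimage_add,
    Measure.addHaar_image_linearMap, LinearMap.det_toLin', Matrix.det_transpose, Real.volume_Icc_pi]
  simp [ENNReal.toReal_mul, hab]

/-- The frontier of a convex set is null, so positive volume forces an interior point. The small
simplex shows that the maximal determinant below is nonzero. -/
lemma exists_ball_simplex {K : Set (Fin d → ℝ)} (hKc : Convex ℝ K) (hvol : volume K ≠ 0) :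
    ∃ o ∈ K, ∃ ε : ℝ, 0 < ε ∧ ∀ i, o + ε • (Pi.single i 1 : Fin d → ℝ) ∈ K := by
  have hint : (interior K).Nonempty := by
    by_contra hne
    rw [Set.not_nonempty_iff_eq_empty] at hne
    apply hvol
    refine measure_mono_null ?_ (hKc.addHaar_frontier volume)
    rw [frontier, hne, Set.sdiff_empty]
    exact subset_closure
  obtain ⟨o, ho⟩ := hint
  obtain ⟨ε, hε, hball⟩ := Metric.isOpen_iff.1 isOpen_interior o ho
  refine ⟨o, interior_subset ho, ε / 2, half_pos hε, fun i => interior_subset (hball ?_)⟩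
  rw [Metric.mem_ball, dist_eq_norm, add_sub_cancel_left, norm_smul, Pi.norm_single, norm_one,
    mul_one, Real.norm_eq_abs, abs_of_pos (half_pos hε)]
  exact half_lt_self hε

/-- A convex body of positive volume contains a simplex of comparable volume. -/
lemma exists_large_simplex {K : Set (Fin d → ℝ)} (hK : IsCompact K) (hKc : Convex ℝ K)
    (hvol : volume K ≠ 0) :
    ∃ o ∈ K, ∃ M : Matrix (Fin d) (Fin d) ℝ, (∀ i, o + M i ∈ K) ∧ M.det ≠ 0 ∧
      volume.real K ≤ 2 ^ d * |M.det| := by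
  obtain ⟨o₀, ho₀, ε, hε, hsimp⟩ := exists_ball_simplex hKc hvol
  set S : Set ((Fin d → ℝ) × (Fin d → Fin d → ℝ)) := K ×ˢ Set.univ.pi fun _ => K
  set F : (Fin d → ℝ) × (Fin d → Fin d → ℝ) → ℝ :=
    fun q => |(Matrix.of fun i j => q.2 i j - q.1 j).det|
  have hScomp : IsCompact S := hK.prod (isCompact_univ_pi fun _ => hK)
  have hF : Continuous F := by
    refine Continuous.abs (Continuous.matrix_det ?_)
    refine continuous_matrix fun i j => ?_
    simp only [Matrix.of_apply]
    fun_prop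
  have hq₀ : (o₀, fun i => o₀ + ε • (Pi.single i 1 : Fin d → ℝ)) ∈ S :=
    ⟨ho₀, fun i _ => hsimp i⟩
  -- Choose a simplex of maximal volume with vertices in `K`.
  obtain ⟨⟨o, p⟩, ⟨ho, hp⟩, hmax⟩ := hScomp.exists_isMaxOn ⟨_, hq₀⟩ hF.continuousOn
  have hmax' : ∀ q ∈ S, F q ≤ F (o, p) := fun q hq => hmax hq
  set M : Matrix (Fin d) (Fin d) ℝ := Matrix.of fun i j => p i j - o j
  have hFM : F (o, p) = |M.det| := rfl
  have hMrow : ∀ i, o + M i = p i := fun i => by ext j; simp [M]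
  have hdet : M.det ≠ 0 := by
    have h1 := hmax' _ hq₀
    have h2 : F (o₀, fun i => o₀ + ε • (Pi.single i 1 : Fin d → ℝ)) = ε ^ d := by
      have : (Matrix.of fun i j => (o₀ + ε • (Pi.single i 1 : Fin d → ℝ)) j - o₀ j) =
          ε • (1 : Matrix (Fin d) (Fin d) ℝ) := by
        ext i j
        simp [Matrix.one_apply, Pi.single_apply, eq_comm]
      simp only [F]
      rw [this, Matrix.det_smul]
      simp [abs_of_pos (pow_pos hε d)]
    rw [h2, hFM] at h1
    exact abs_pos.1 ((pow_pos hε d).trans_le h1)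
  refine ⟨o, ho, M, fun i => hMrow i ▸ hp i (Set.mem_univ i), hdet, ?_⟩
  have hunit : IsUnit M.transpose.det := by rw [Matrix.det_transpose]; exact isUnit_iff_ne_zero.2 hdet
  have hsub : K ⊆ (fun s => o + M.transpose.mulVec s) '' Set.Icc (fun _ => -1) fun _ => 1 := by
    intro x hx
    set s := M.transpose⁻¹.mulVec (x - o)
    have hs : M.transpose.mulVec s = x - o := by
      rw [Matrix.mulVec_mulVec, Matrix.mul_nonsing_inv _ hunit, Matrix.one_mulVec]
    -- Replacing the `i`-th vertex by `x` multiplies the determinant by `s i`, so maximality bounds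
    -- `|s i|`, and `K` lies in a parallelepiped of side 2 in these coordinates.
    have habs : ∀ i, |s i| ≤ 1 := by
      intro i
      have h1 := hmax' (o, Function.update p i x) ⟨ho, fun j _ => by
        by_cases hji : j = i
        · subst hji; simpa using hx
        · simpa [hji] using hp j (Set.mem_univ j)⟩
      have h2 : (Matrix.of fun k j => (Function.update p i x) k j - o j) =
          M.updateRow i (∑ k, s k • M k) := by
        have h3 : ∑ k, s k • M k = x - o := by
          rw [← hs]; ext j
          simp [Matrix.mulVec, dotProduct, mul_comm]
        rw [h3]
        ext k j
        by_cases hki : k = i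
        · subst hki; simp
        · simp [hki, M]
      simp only [F] at h1
      rw [h2, Matrix.det_updateRow_sum, smul_eq_mul, abs_mul] at h1
      exact le_of_mul_le_mul_right (by simpa [one_mul] using h1) (abs_pos.2 hdet)
    refine ⟨s, ⟨fun i => (abs_le.1 (habs i)).1, fun i => (abs_le.1 (habs i)).2⟩, ?_⟩
    simp [hs]
  have hfin : volume ((fun s => o + M.transpose.mulVec s) '' Set.Icc (fun _ => (-1 : ℝ)) fun _ => 1) ≠ ⊤ :=
    (isCompact_Icc.image (by fun_prop)).measure_lt_top.ne
  refine (measureReal_mono hsub hfin).trans_eq ?_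
  rw [volume_real_parallelepiped o M (by norm_num)]
  norm_num [mul_comm]

/-- The point is the average of the `d` points `o + (d * s i) • M i`, each on a segment inside `K`;
hence the bound `1 / d`. -/
lemma add_mulVec_mem {K : Set (Fin d → ℝ)} (hd : 1 ≤ d) (hKc : Convex ℝ K) {o : Fin d → ℝ} (ho : o ∈ K)
    {M : Matrix (Fin d) (Fin d) ℝ} (hM : ∀ i, o + M i ∈ K) {s : Fin d → ℝ}
    (hs : ∀ i, 0 ≤ s i ∧ s i ≤ 1 / d) : o + M.transpose.mulVec s ∈ K := by
  have hd' : (0 : ℝ) < d := by exact_mod_cast hd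
  have h1 : ∀ i, o + (d * s i) • M i ∈ K := fun i =>
    hKc.add_smul_mem ho (hM i) ⟨mul_nonneg hd'.le (hs i).1, by
      have := mul_le_mul_of_nonneg_left (hs i).2 hd'.le
      rwa [mul_one_div_cancel hd'.ne'] at this⟩
  have h2 : o + M.transpose.mulVec s = ∑ i : Fin d, (1 / d : ℝ) • (o + (d * s i) • M i) := by
    simp_rw [smul_add, Finset.sum_add_distrib, smul_smul]
    congr 1
    · simp [hd'.ne', ← Nat.cast_smul_eq_nsmul ℝ, smul_smul]
    · ext j
      simp [Matrix.mulVec, dotProduct, mul_comm, hd'.ne']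
  rw [h2]
  exact hKc.sum_mem (fun _ _ => by positivity) (by simp [hd'.ne']) fun i _ => h1 i

/-- By Cramer's rule: each adjugate entry is a determinant with entries at most 1 in modulus, so at
most `d!`. -/
lemma abs_inv_transpose_le {M : Matrix (Fin d) (Fin d) ℝ} (hM : ∀ i j, |M i j| ≤ 1) (i j : Fin d) :
    |M.transpose⁻¹ i j| ≤ d.factorial / |M.det| := by
  rw [Matrix.inv_def, Matrix.smul_apply, smul_eq_mul, Ring.inverse_eq_inv', Matrix.det_transpose,
    abs_mul, abs_inv, inv_mul_eq_div, Matrix.adjugate_apply]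
  refine div_le_div_of_nonneg_right ?_ (abs_nonneg _)
  have := Matrix.det_le (A := M.transpose.updateRow j (Pi.single i 1)) (abv := AbsoluteValue.abs)
    (x := (1 : ℝ)) (fun k l => by
      by_cases hk : k = j
      · subst hk
        by_cases hl : l = i
        · subst hl; simp
        · simp [hl]
      · simpa [hk] using hM l k)
  simpa using this

/-- The part of the unit cube cut out by `d` slabs with integer coefficients. -/
def slabSet (N : ℕ) (B : Fin d → Fin d → ℤ) (β : Fin d → ℤ) : Set (Fin d → ℝ) :=
  {x | x ∈ piCube d ∧ ∀ i, 1 / (4 * d : ℝ) ≤ (β i + ∑ j, (B i j : ℝ) * x j) / N ∧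
    (β i + ∑ j, (B i j : ℝ) * x j) / N ≤ 1 / (2 * d : ℝ)}

lemma slabSet_subset (N : ℕ) (B : Fin d → Fin d → ℤ) (β : Fin d → ℤ) :
    slabSet N B β ⊆ piCube d := fun _ hx => hx.1

lemma abs_sum_mul_le {w u : Fin d → ℝ} {c e : ℝ} (hw : ∀ j, |w j| ≤ c) (hu : ∀ j, |u j| ≤ e) :
    |∑ j, w j * u j| ≤ d * (c * e) := by
  refine (Finset.abs_sum_le_sum_abs _ _).trans ?_
  have : ∀ j ∈ Finset.univ, |w j * u j| ≤ c * e := fun j _ => by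
    rw [abs_mul]
    exact mul_le_mul (hw j) (hu j) (abs_nonneg _) ((abs_nonneg _).trans (hw j))
  simpa using Finset.sum_le_sum this

lemma abs_le_one_of_mem_piCube {x : Fin d → ℝ} (hx : x ∈ piCube d) (i : Fin d) : |x i| ≤ 1 :=
  abs_le.2 ⟨by linarith [hx.1 i, show (0 : Fin d → ℝ) i = 0 from rfl], hx.2 i⟩

/-- Every convex body in the unit cube that is not too small contains, with some room to spare,
a slab set of comparable volume with integer coefficients of polynomial size. -/
lemma exists_slabSet (hd : 1 ≤ d) {N : ℕ} (hN1 : 16 * d * (d + 1) ≤ N)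
    (hN2 : d * 2 ^ d * d.factorial ≤ N)
    {K : Set (Fin d → ℝ)} (hK : IsCompact K) (hKc : Convex ℝ K) (hKcube : K ⊆ piCube d)
    (hvol : 1 / (N : ℝ) ≤ volume.real K) :
    ∃ B : Fin d → Fin d → ℤ, ∃ β : Fin d → ℤ, (∀ i j, |B i j| ≤ (N ^ 4 : ℕ)) ∧
      (∀ i, |β i| ≤ (N ^ 4 : ℕ)) ∧
      (1 / (16 * d : ℝ)) ^ d * volume.real K ≤ volume.real (slabSet N B β) ∧
      ∀ y ∈ slabSet N B β, ∀ z : Fin d → ℝ, (∀ i, |z i - y i| ≤ 1 / (N : ℝ) ^ 3) → z ∈ K := by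
  have hd' : (1 : ℝ) ≤ d := by exact_mod_cast hd
  have hN1' : 16 * (d : ℝ) * (d + 1) ≤ N := by exact_mod_cast hN1
  have hN2' : (d : ℝ) * 2 ^ d * d.factorial ≤ N := by exact_mod_cast hN2
  have hN32 : (32 : ℝ) ≤ N := by nlinarith
  have hNpos : (0 : ℝ) < N := by linarith
  have hvol0 : volume K ≠ 0 := by
    intro h0
    rw [measureReal_def, h0, ENNReal.toReal_zero] at hvol
    exact absurd hvol (not_le.2 (by positivity))
  obtain ⟨o, ho, M, hM, hdet, hKM⟩ := exists_large_simplex hK hKc hvol0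
  have hdetpos : 0 < |M.det| := abs_pos.2 hdet
  have hocube := hKcube ho
  have hMabs : ∀ i j, |M i j| ≤ 1 := by
    intro i j
    have h1 := hKcube (hM i)
    have h2 := h1.1 j
    have h3 := h1.2 j
    have h4 := hocube.1 j
    have h5 := hocube.2 j
    simp only [Pi.add_apply, Pi.zero_apply, Pi.one_apply] at h2 h3 h4 h5
    exact abs_le.2 ⟨by linarith, by linarith⟩
  have hunit : IsUnit M.transpose.det := by rw [Matrix.det_transpose]; exact isUnit_iff_ne_zero.2 hdet
  set W := M.transpose⁻¹ with hW
  have hdW : ∀ i j, d * |W i j| ≤ (N : ℝ) ^ 2 := by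
    intro i j
    have h1 := abs_inv_transpose_le hMabs i j
    have h2 : (d.factorial : ℝ) / |M.det| ≤ 2 ^ d * d.factorial * N := by
      rw [div_le_iff₀ hdetpos]
      have h3 : 1 ≤ N * (2 ^ d * |M.det|) := by
        have := hvol.trans hKM
        rw [div_le_iff₀ hNpos] at this
        linarith
      have h4 : (0 : ℝ) ≤ d.factorial := by positivity
      nlinarith
    calc (d : ℝ) * |W i j| ≤ d * (2 ^ d * d.factorial * N) := by gcongr; exact h1.trans h2
      _ = (d * 2 ^ d * d.factorial) * N := by ring
      _ ≤ N * N := by gcongr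
      _ = _ := by ring
  have hWabs : ∀ i j, |W i j| ≤ (N : ℝ) ^ 2 / d := fun i j => by
    rw [le_div_iff₀ (by linarith), mul_comm]; exact hdW i j
  set γ : Fin d → ℝ := fun i => -∑ j, W i j * o j with hγ
  have hγabs : ∀ i, |γ i| ≤ (N : ℝ) ^ 2 := fun i => by
    rw [hγ, abs_neg]
    have := abs_sum_mul_le (hWabs i) fun j => abs_le_one_of_mem_piCube hocube j
    rwa [mul_one, mul_div_cancel₀ _ (by linarith)] at this
  have hround : ∀ w : ℝ, |w| ≤ (N : ℝ) ^ 2 → |⌊N * w⌋| ≤ ((N ^ 4 : ℕ) : ℤ) := by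
    intro w hw
    have h1 := Int.floor_le (N * w)
    have h2 := Int.lt_floor_add_one (N * w)
    have h3 := abs_le.1 hw
    have h4 : (N : ℝ) ^ 3 + 1 ≤ N ^ 4 := by
      have : (1 : ℝ) ≤ N ^ 3 := one_le_pow₀ (by linarith)
      nlinarith
    have h5 : (N : ℝ) * w ≤ N ^ 3 := by nlinarith
    have h6 : -(N : ℝ) ^ 3 ≤ N * w := by nlinarith
    have : |(⌊N * w⌋ : ℝ)| ≤ (N : ℝ) ^ 4 := abs_le.2 ⟨by linarith, by linarith⟩
    exact_mod_cast this
  have hfl : ∀ w : ℝ, |(⌊N * w⌋ : ℝ) / N - w| ≤ 1 / N := by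
    intro w
    have h1 := Int.floor_le (N * w)
    have h2 := Int.lt_floor_add_one (N * w)
    have : (⌊N * w⌋ : ℝ) / N - w = (⌊N * w⌋ - N * w) / N := by field_simp
    rw [this, abs_div, abs_of_pos hNpos]
    exact div_le_div_of_nonneg_right (abs_le.2 ⟨by linarith, by linarith⟩) hNpos.le
  set B : Fin d → Fin d → ℤ := fun i j => ⌊N * W i j⌋ with hB
  set β : Fin d → ℤ := fun i => ⌊N * γ i⌋ with hβ
  have hη : ((d : ℝ) + 1) / N ≤ 1 / (16 * d) := by
    rw [div_le_div_iff₀ hNpos (by linarith)]; linarith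
  have hlam : ∀ x i, W.mulVec (x - o) i = γ i + ∑ j, W i j * x j := by
    intro x i
    simp only [Matrix.mulVec, dotProduct, Pi.sub_apply, mul_sub, Finset.sum_sub_distrib, hγ]
    ring
  have happrox : ∀ x ∈ piCube d, ∀ i,
      |((β i + ∑ j, (B i j : ℝ) * x j) / N) - W.mulVec (x - o) i| ≤ 1 / (16 * d) := by
    intro x hx i
    have h1 : ((β i + ∑ j, (B i j : ℝ) * x j) / N) - W.mulVec (x - o) i =
        ((β i : ℝ) / N - γ i) + ∑ j, ((B i j : ℝ) / N - W i j) * x j := by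
      rw [hlam]
      simp only [sub_mul, Finset.sum_sub_distrib, add_div, Finset.sum_div, div_mul_eq_mul_div]
      ring
    rw [h1]
    have h2 := abs_sum_mul_le (fun j => hfl (W i j)) fun j => abs_le_one_of_mem_piCube hx j
    have h3 := hfl (γ i)
    refine ((abs_add_le _ _).trans (add_le_add h3 h2)).trans (le_trans (le_of_eq ?_) hη)
    ring
  have hd4 : 1 / (4 * d : ℝ) = 4 * (1 / (16 * d)) := by field_simp; norm_num
  have hd2 : 1 / (2 * d : ℝ) = 8 * (1 / (16 * d)) := by field_simp; norm_num
  have hd1 : 1 / (d : ℝ) = 16 * (1 / (16 * d)) := by field_simp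
  -- Budget in units of `e`: the simplex contains all coordinates in `[0, 16e]`, the slabs are `[4e,
  -- 8e]`, and rounding costs at most `e`. So `[5e, 7e]` lies inside the slabs, giving the volume,
  -- and slab points have coordinates in `[3e, 9e]`; moving by `N⁻³` costs at most `1/N ≤ e` more.
  set e := 1 / (16 * d : ℝ) with he
  have he0 : 0 < e := by positivity
  refine ⟨B, β, fun i j => hround _ ?_, fun i => hround _ (hγabs i), ?_, ?_⟩
  · exact (le_mul_of_one_le_left (abs_nonneg _) hd').trans (hdW i j)
  · have hsub : (fun s => o + M.transpose.mulVec s) '' Set.Icc (fun _ => 5 * e) (fun _ => 7 * e) ⊆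
        slabSet N B β := by
      rintro _ ⟨s, ⟨hs1, hs2⟩, rfl⟩
      have hmem : o + M.transpose.mulVec s ∈ K := add_mulVec_mem hd hKc ho hM fun i =>
        ⟨(by positivity : 0 ≤ 5 * e).trans (hs1 i), (hs2 i).trans (by rw [hd1]; linarith)⟩
      refine ⟨hKcube hmem, fun i => ?_⟩
      have h1 := happrox _ (hKcube hmem) i
      have h2 : W.mulVec (o + M.transpose.mulVec s - o) = s := by
        rw [add_sub_cancel_left, Matrix.mulVec_mulVec, Matrix.nonsing_inv_mul _ hunit,
          Matrix.one_mulVec]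
      rw [h2] at h1
      have h3 := abs_le.1 h1
      have h4 := hs1 i
      have h5 := hs2 i
      rw [hd4, hd2]
      constructor <;> linarith
    have h1 := measureReal_mono hsub (volume_ne_top_of_subset_piCube (slabSet_subset N B β))
    rw [volume_real_parallelepiped o M (by linarith)] at h1
    refine le_trans ?_ h1
    calc e ^ d * volume.real K ≤ e ^ d * (2 ^ d * |M.det|) := by gcongr
      _ = |M.det| * (7 * e - 5 * e) ^ d := by
        rw [show 7 * e - 5 * e = 2 * e by ring, mul_pow]; ring
  · rintro y ⟨hy, hyi⟩ z hz
    have h1 : z = o + M.transpose.mulVec (W.mulVec (z - o)) := by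
      rw [Matrix.mulVec_mulVec, Matrix.mul_nonsing_inv _ hunit, Matrix.one_mulVec,
        add_sub_cancel]
    rw [h1]
    refine add_mulVec_mem hd hKc ho hM fun i => ?_
    have h2 := abs_le.1 (happrox y hy i)
    have h3 : |W.mulVec (z - o) i - W.mulVec (y - o) i| ≤ 1 / N := by
      rw [hlam, hlam, add_sub_add_left_eq_sub, ← Finset.sum_sub_distrib]
      simp_rw [← mul_sub]
      refine (abs_sum_mul_le (hWabs i) hz).trans (le_of_eq ?_)
      field_simp
    have h4 : 1 / (N : ℝ) ≤ e := le_trans (by gcongr; linarith) hη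
    have h5 := abs_le.1 h3
    have h6 := hyi i
    rw [hd4, hd2] at h6
    rw [hd1]
    constructor <;> linarith [h6.1, h6.2]

end Geometry

/-! ### Choice of parameters at scale `N`. -/

/-- The union-bound exponent in dimension `d`. -/
def unionExponent (d : ℕ) : ℕ := 5 * (d * d + d) + 2

/-- Admissible choices, at scale `N`, of the index step `s`, the number `J` of terms used, and
their growth ratio `R`. -/
structure ScaleParams (d : ℕ) (r Υ C : ℝ) (N s J : ℕ) (R : ℝ) : Prop where
  five_le : 5 ≤ N
  le_one : 16 * d * (d + 1) ≤ N
  le_two : d * 2 ^ d * d.factorial ≤ N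
  log_le : 1 ≤ C * Real.log N ^ 2
  index_le : s * J + 1 ≤ N
  ratio_le : R ≤ r ^ s
  le_ratio : 4 * ((N ^ 7 : ℕ) : ℝ) ≤ R
  tail_le : (2 * ((N ^ 7 : ℕ) : ℝ)) ^ d * Real.exp (-(4 * (1 / (N : ℝ) ^ 3) ^ 2 * ((N ^ 7 : ℕ) : ℝ))) ≤ 1 / (N : ℝ) ^ 2
  error_le : ((2 * (N ^ 7 : ℕ) + 1) ^ d + 2 : ℝ) * R ^ (-Υ) ≤ 1 / (N : ℝ) ^ unionExponent d
  le_volume : 1 / (N : ℝ) ^ 2 ≤ (1 / (16 * d : ℝ)) ^ d * (C * Real.log N ^ 2 / N)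
  pow_le : Real.exp (-((1 / (16 * d : ℝ)) ^ d * (C * Real.log N ^ 2 / N) - 1 / (N : ℝ) ^ 2)) ^ J ≤
    1 / (N : ℝ) ^ unionExponent d

lemma card_mul_le {N : ℕ} (hN : 5 ≤ N) (d : ℕ) :
    (2 * (N : ℝ) ^ 4 + 1) ^ (d * d + d) * (1 / (N : ℝ) ^ unionExponent d) ≤ 1 / (N : ℝ) ^ 2 := by
  have hN' : (5 : ℝ) ≤ N := by exact_mod_cast hN
  have h1 : 2 * (N : ℝ) ^ 4 + 1 ≤ N ^ 5 := by
    have : (1 : ℝ) ≤ N ^ 4 := one_le_pow₀ (by linarith)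
    nlinarith
  calc (2 * (N : ℝ) ^ 4 + 1) ^ (d * d + d) * (1 / (N : ℝ) ^ unionExponent d)
      ≤ (N ^ 5) ^ (d * d + d) * (1 / (N : ℝ) ^ unionExponent d) := by gcongr
    _ = 1 / (N : ℝ) ^ 2 := by
      rw [unionExponent, pow_add _ (5 * (d * d + d)) 2, ← pow_mul (N : ℝ) 5]
      field_simp

/-- Degree `N⁷` against room `N⁻³` makes the exponent `4N`, which beats every power of `N`. -/
lemma eventually_tail_le (d : ℕ) : ∀ᶠ N : ℕ in Filter.atTop,
    (2 * ((N ^ 7 : ℕ) : ℝ)) ^ d * Real.exp (-(4 * (1 / (N : ℝ) ^ 3) ^ 2 * ((N ^ 7 : ℕ) : ℝ))) ≤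
      1 / (N : ℝ) ^ 2 := by
  have h := ((Real.tendsto_pow_mul_exp_neg_atTop_nhds_zero (7 * d + 2)).comp
    (tendsto_natCast_atTop_atTop (R := ℝ))).const_mul (2 ^ d : ℝ)
  rw [mul_zero] at h
  filter_upwards [h.eventually_le_const one_pos, Filter.eventually_ge_atTop 1] with N hN hN1
  have hNpos : (0 : ℝ) < N := by exact_mod_cast hN1
  simp only [Function.comp_apply] at hN
  have h1 : 4 * (1 / (N : ℝ) ^ 3) ^ 2 * ((N ^ 7 : ℕ) : ℝ) = 4 * N := by
    push_cast; field_simp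
  rw [h1, le_div_iff₀ (by positivity)]
  refine le_trans ?_ hN
  have h2 : Real.exp (-(4 * (N : ℝ))) ≤ Real.exp (-N) := Real.exp_le_exp.2 (by linarith)
  calc (2 * ((N ^ 7 : ℕ) : ℝ)) ^ d * Real.exp (-(4 * (N : ℝ))) * N ^ 2
      ≤ (2 * ((N ^ 7 : ℕ) : ℝ)) ^ d * Real.exp (-N) * N ^ 2 := by gcongr
    _ = 2 ^ d * (N ^ (7 * d + 2) * Real.exp (-N)) := by
      push_cast; rw [mul_pow, ← pow_mul, pow_add]; ring

lemma error_rpow_le {d : ℕ} (hd : 1 ≤ d) {N : ℕ} (hN5 : 5 ≤ N) (F : ℕ) {ρ Υ : ℝ}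
    (hρΥ : 8 * d + F ≤ ρ * Υ) :
    ((2 * (N ^ 7 : ℕ) + 1) ^ d + 2 : ℝ) * ((N : ℝ) ^ ρ) ^ (-Υ) ≤ 1 / (N : ℝ) ^ F := by
  have hN : (5 : ℝ) ≤ N := by exact_mod_cast hN5
  have hNpos : (0 : ℝ) < N := by linarith
  have hL : ((2 * (N ^ 7 : ℕ) + 1) ^ d + 2 : ℝ) ≤ (N : ℝ) ^ (8 * d) := by
    push_cast
    have h7 : (1 : ℝ) ≤ N ^ 7 := one_le_pow₀ (by linarith)
    have h2 : (2 * (N : ℝ) ^ 7 + 1) ^ d + 2 ^ d ≤ (2 * (N : ℝ) ^ 7 + 1 + 2) ^ d :=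
      pow_add_pow_le (by positivity) (by norm_num) (by omega)
    have h3 : (2 : ℝ) ≤ 2 ^ d := le_self_pow₀ (by norm_num) (by omega)
    have h4 : 2 * (N : ℝ) ^ 7 + 1 + 2 ≤ (N : ℝ) ^ 8 := by
      rw [show (N : ℝ) ^ 8 = N * N ^ 7 by ring]; nlinarith
    calc (2 * (N : ℝ) ^ 7 + 1) ^ d + 2 ≤ (2 * (N : ℝ) ^ 7 + 1 + 2) ^ d := by linarith
      _ ≤ ((N : ℝ) ^ 8) ^ d := pow_le_pow_left₀ (by positivity) h4 d
      _ = _ := by rw [← pow_mul]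
  have hRΥ : ((N : ℝ) ^ ρ) ^ (-Υ) ≤ 1 / (N : ℝ) ^ (8 * d + F) := by
    rw [← Real.rpow_mul hNpos.le, mul_neg, Real.rpow_neg hNpos.le, ← one_div]
    refine one_div_le_one_div_of_le (by positivity) ?_
    rw [← Real.rpow_natCast]
    refine Real.rpow_le_rpow_of_exponent_le (by linarith) ?_
    push_cast; exact hρΥ
  calc _ ≤ (N : ℝ) ^ (8 * d) * (1 / (N : ℝ) ^ (8 * d + F)) := by gcongr
    _ = 1 / (N : ℝ) ^ F := by rw [pow_add]; field_simp

/-- For a suitable constant `C`, admissible parameters exist at all large scales. -/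
lemma exists_scaleParams {d : ℕ} (hd : 1 ≤ d) {r Υ : ℝ} (hr : 1 < r) (hΥ : 0 < Υ) :
    ∃ C : ℝ, 0 < C ∧ ∀ᶠ N : ℕ in Filter.atTop, ∃ s J : ℕ, ∃ R : ℝ, ScaleParams d r Υ C N s J R := by
  have hd' : (1 : ℝ) ≤ d := by exact_mod_cast hd
  have hlr : 0 < Real.log r := Real.log_pos hr
  set F := unionExponent d
  have hF : 0 < (F : ℝ) := by
    have : 0 < F := by simp [F, unionExponent]
    exact_mod_cast this
  -- The value 9 ensures `4N⁷ ≤ R = N^ρ`; the other one makes the Fourier error at most `N^(-F)`.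
  set ρ : ℝ := max 9 ((8 * d + F) / Υ)
  have hρ9 : 9 ≤ ρ := le_max_left _ _
  have hρΥ : 8 * d + F ≤ ρ * Υ := by
    rw [← div_le_iff₀ hΥ]; exact le_max_right _ _
  set κ : ℝ := (1 / (16 * d : ℝ)) ^ d
  have hκ : 0 < κ := by positivity
  -- The 8 is three losses of a factor 2: the ceiling in `s`, the floor in `J`, and the subtraction
  -- of `N⁻²` from the volume.
  set C : ℝ := 8 * ρ * F / (κ * Real.log r) with hC
  have hCpos : 0 < C := by positivity
  have hlog : Filter.Tendsto (fun N : ℕ => Real.log N) Filter.atTop Filter.atTop :=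
    Real.tendsto_log_atTop.comp tendsto_natCast_atTop_atTop
  have hlogsq := ((Filter.tendsto_pow_atTop (two_ne_zero)).comp hlog)
  have hlogo : ∀ᶠ N : ℕ in Filter.atTop, Real.log N ≤ Real.log r / (8 * ρ) * N := by
    have h := (Real.isLittleO_log_id_atTop.comp_tendsto (tendsto_natCast_atTop_atTop (R := ℝ))).bound
      (show 0 < Real.log r / (8 * ρ) by positivity)
    filter_upwards [h] with N hN
    simp only [Function.comp_apply, id, Real.norm_eq_abs, Nat.abs_cast] at hN
    exact (le_abs_self _).trans hN
  refine ⟨C, hCpos, ?_⟩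
  filter_upwards [Filter.eventually_ge_atTop 5, Filter.eventually_ge_atTop (16 * d * (d + 1)),
    Filter.eventually_ge_atTop (d * 2 ^ d * d.factorial), eventually_tail_le d, hlogo,
    hlogsq.eventually_ge_atTop (1 / C), hlogsq.eventually_ge_atTop (2 / (κ * C)),
    hlog.eventually_ge_atTop (Real.log r / ρ)] with N h5 h16 hfac htail hlo hsq1 hsq2 hlg
  simp only [Function.comp_apply] at hsq1 hsq2
  have hN : (5 : ℝ) ≤ N := by exact_mod_cast h5
  have hNpos : (0 : ℝ) < N := by linarith
  set l := Real.log N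
  have hl : 0 < l := Real.log_pos (by linarith)
  set s : ℕ := ⌈ρ * l / Real.log r⌉₊
  set R : ℝ := (N : ℝ) ^ ρ
  have hs_ge : ρ * l / Real.log r ≤ s := Nat.le_ceil _
  have hs_pos : (0 : ℝ) < s := lt_of_lt_of_le (by positivity) hs_ge
  have hs_le : s ≤ 2 * (ρ * l / Real.log r) := by
    have h1 := (Nat.ceil_lt_add_one (show 0 ≤ ρ * l / Real.log r by positivity)).le
    have h2 : 1 ≤ ρ * l / Real.log r := by
      rw [le_div_iff₀ hlr, one_mul]
      rw [div_le_iff₀ (by linarith)] at hlg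
      linarith
    linarith
  have hNs : 4 * (s : ℝ) ≤ N := by
    have h1 : 8 * (ρ * l / Real.log r) ≤ N := by
      calc 8 * (ρ * l / Real.log r) ≤ 8 * (ρ * (Real.log r / (8 * ρ) * N) / Real.log r) := by gcongr
        _ = N := by field_simp
    linarith
  set J : ℕ := (N - 1) / s
  have hJ : (N : ℝ) / (2 * s) ≤ J := by
    have h1 : N - 1 < (J + 1) * s := by
      have := Nat.lt_div_mul_add (a := N - 1) (b := s) (by exact_mod_cast hs_pos)
      rw [add_mul, one_mul]; exact this
    have h2 : (N : ℝ) ≤ (J + 1) * s := by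
      have : N ≤ (J + 1) * s := by omega
      exact_mod_cast this
    rw [div_le_iff₀ (by positivity)]
    nlinarith
  have hsqκ : 2 ≤ κ * (C * l ^ 2) := by
    rw [div_le_iff₀ (by positivity)] at hsq2; linarith
  have hvol : 2 * (1 / (N : ℝ) ^ 2) ≤ κ * (C * l ^ 2 / N) := by
    calc 2 * (1 / (N : ℝ) ^ 2) ≤ 2 / N := by
          rw [mul_one_div]
          exact div_le_div_of_nonneg_left (by norm_num) hNpos (by nlinarith)
      _ ≤ κ * (C * l ^ 2) / N := by gcongr
      _ = _ := by ring
  refine ⟨s, J, R, h5, h16, hfac, ?_, ?_, ?_, ?_, htail, ?_, ?_, ?_⟩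
  · rw [div_le_iff₀ hCpos] at hsq1; linarith
  · have := Nat.mul_div_le (N - 1) s
    show s * ((N - 1) / s) + 1 ≤ N
    omega
  · have h1 : R = Real.exp (l * ρ) := Real.rpow_def_of_pos hNpos ρ
    rw [h1, ← Real.rpow_natCast, Real.rpow_def_of_pos (by linarith), Real.exp_le_exp]
    rw [div_le_iff₀ hlr] at hs_ge
    linarith
  · have h1 : (N : ℝ) ^ 9 ≤ R := by
      rw [← Real.rpow_natCast]
      exact Real.rpow_le_rpow_of_exponent_le (by linarith) (by exact_mod_cast hρ9)
    refine le_trans ?_ h1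
    push_cast
    rw [show (N : ℝ) ^ 9 = N ^ 2 * N ^ 7 by ring]
    gcongr
    nlinarith
  · exact error_rpow_le hd h5 F hρΥ
  · have : 0 < 1 / (N : ℝ) ^ 2 := by positivity
    linarith
  · rw [← Real.exp_nat_mul]
    have h1 : 1 / (N : ℝ) ^ F = Real.exp (-(F * l)) := by
      rw [Real.exp_neg, Real.exp_nat_mul, Real.exp_log hNpos, one_div]
    rw [h1, Real.exp_le_exp, mul_neg, neg_le_neg_iff]
    calc F * l = κ * (C * l ^ 2) / (4 * (2 * (ρ * l / Real.log r))) := by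
          rw [hC]; field_simp; norm_num
      _ ≤ κ * (C * l ^ 2) / (4 * s) := by gcongr
      _ = N / (2 * s) * (κ * (C * l ^ 2 / N) / 2) := by field_simp; norm_num
      _ ≤ J * (κ * (C * l ^ 2 / N) - 1 / (N : ℝ) ^ 2) := by
          refine mul_le_mul hJ (by linarith) (by positivity) (by positivity)

/-! ### Probability of missing one slab set. -/

lemma IsLacunary.pow_mul_le {r : ℝ} (hr : 0 ≤ r) {a : ℕ → ℤ} (ha : IsLacunary r a) {n : ℕ}
    (hn : 1 ≤ n) (s : ℕ) : r ^ s * a n ≤ a (n + s) := by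
  induction s with
  | zero => simp
  | succ s ih =>
    rw [pow_succ', mul_assoc]
    exact (mul_le_mul_of_nonneg_left ih hr).trans (ha.gap (n + s) (by omega))

/-- A point of the cube outside `K` is far, modulo one, from a set lying well inside `K`. -/
lemma smoothIndicator_le_of_notMem {d : ℕ} {P K : Set (Fin d → ℝ)} (hP : P ⊆ piCube d)
    (hK : K ⊆ piCube d) {δ : ℝ} (hδ : 0 ≤ δ)
    (hroom : ∀ y ∈ P, ∀ z : Fin d → ℝ, (∀ i, |z i - y i| ≤ δ) → z ∈ K) {m : ℕ} (hm : 1 ≤ m)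
    {x : Fin d → ℝ} (hx : x ∈ piCube d) (hxK : x ∉ K) :
    smoothIndicator P m x ≤ (2 * m) ^ d * Real.exp (-(4 * δ ^ 2 * m)) := by
  refine smoothIndicator_le_of_far hP hm hδ fun y hy => ?_
  have h1 : ∃ i, δ < |x i - y i| := by
    by_contra hcon
    push Not at hcon
    exact hxK (hroom y hy x hcon)
  obtain ⟨i, hi⟩ := h1
  -- Shifting `y` diagonally by `±δ` stays in the cube, so `δ ≤ y i ≤ 1 - δ`; thus `x` cannot be
  -- close to `y` by wrapping around modulo 1.
  have h2 := hK (hroom y hy (fun j => y j + δ) fun j => by simp [abs_of_nonneg hδ])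
  have h3 := hK (hroom y hy (fun j => y j - δ) fun j => by simp [abs_of_nonneg hδ])
  have h4 := h2.2 i
  have h5 := h3.1 i
  have h6 := hx.1 i
  have h7 := hx.2 i
  simp only [Pi.zero_apply, Pi.one_apply] at h4 h5 h6 h7
  exact ⟨i, hi.le, abs_le.2 ⟨by linarith, by linarith⟩⟩

section Probability

variable {Ω : Type*} [MeasurableSpace Ω] {μ : Measure Ω} [IsProbabilityMeasure μ]
  {d : ℕ} {X : Ω → Fin d → ℝ}

/-- The event that all the dilates `b j • X`, `j < J`, essentially miss `P` modulo one. -/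
def missEvent (X : Ω → Fin d → ℝ) (b : ℕ → ℤ) (J : ℕ) (P : Set (Fin d → ℝ)) (m : ℕ) (ε : ℝ) :
    Set Ω :=
  {ω | ∀ j < J, smoothIndicator P m (fun i => X ω i * b j) ≤ ε}

lemma measure_missEvent_le (hX : Measurable X) {A Υ : ℝ} (hA : 0 ≤ A) (hΥ : 0 < Υ)
    (hdec : HasIntFourierDecay μ X A Υ) {m : ℕ} (hm : 1 ≤ m) {b : ℕ → ℤ} {R : ℝ}
    (hR : 4 * m ≤ R) (hb0 : R ≤ b 0) (hb : ∀ j, R * b j ≤ b (j + 1))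
    {P : Set (Fin d → ℝ)} (hP : P ⊆ piCube d) {ε v : ℝ} (hε : 0 ≤ ε) (hε1 : ε ≤ 1) (hεv : ε ≤ v)
    (hv : v ≤ volume.real P)
    (hLR : ((2 * m + 1) ^ d + 2 : ℝ) * R ^ (-Υ) ≤ 1 / 2) (J : ℕ) :
    μ.real (missEvent X b J P m ε) ≤
      Real.exp (-(v - ε)) ^ J + 2 ^ (1 + Υ) * A * (((2 * m + 1) ^ d + 2 : ℝ) * R ^ (-Υ)) := by
  -- Coefficients of `1 + ε - f`, where `f` is the smoothed indicator of `P`.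
  set c : (Fin d → ℤ) → ℂ := fun k => (if k = 0 then ((1 + ε : ℝ) : ℂ) else 0) - smoothCoeff P m k
    with hc
  have h0mem : (0 : Fin d → ℤ) ∈ freqBox d m := by simp [mem_freqBox]
  have heval : ∀ x, trigEval m c x = ((1 + ε - smoothIndicator P m x : ℝ) : ℂ) := by
    intro x
    rw [trigEval, Complex.ofReal_sub, smoothIndicator_eq_sum hP]
    simp only [hc, sub_mul, Finset.sum_sub_distrib, ite_mul, zero_mul]
    rw [Finset.sum_ite_eq' _ _, if_pos h0mem, phase_zero_left, expUnit_zero, mul_one]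
  have hc0 : c 0 = ((1 + ε - volume.real P : ℝ) : ℂ) := by
    simp [hc, smoothCoeff_zero]
  have hc0norm : ‖c 0‖ = 1 + ε - volume.real P := by
    rw [hc0, Complex.norm_real, Real.norm_eq_abs, abs_of_nonneg]
    have := volume_real_le_one hP
    linarith
  have hcL : coeffNorm m c ≤ (2 * m + 1) ^ d + 2 := by
    have h1 : ∀ k ∈ freqBox d m, ‖c k‖ ≤ (if k = 0 then 2 else 0) + 1 := by
      intro k _
      refine (norm_sub_le _ _).trans (add_le_add ?_ (norm_smoothCoeff_le hP m k))
      split_ifs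
      · rw [Complex.norm_real, Real.norm_eq_abs, abs_of_nonneg (by linarith)]; linarith
      · simp
    refine (Finset.sum_le_sum h1).trans_eq ?_
    rw [Finset.sum_add_distrib, Finset.sum_ite_eq' _ _, if_pos h0mem, Finset.sum_const,
      card_freqBox]
    simp; ring
  have hmain := norm_integral_prod_le_of_lacunary hX hA hΥ hdec hm c (by linarith) hR hb0 hb hcL
    hLR J
  simp_rw [heval] at hmain
  set g : Ω → ℝ := fun ω => ∏ j ∈ Finset.range J, (1 + ε - smoothIndicator P m (fun i => X ω i * b j))
    with hg
  have hgC : ∀ ω, ∏ j ∈ Finset.range J, ((1 + ε - smoothIndicator P m (fun i => X ω i * b j) : ℝ) : ℂ) =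
      (g ω : ℂ) := fun ω => by rw [hg]; push_cast; rfl
  simp_rw [hgC] at hmain
  rw [integral_complex_ofReal, Complex.norm_real] at hmain
  have hcont := continuous_smoothIndicator hP m
  have hfac : ∀ ω j, 0 ≤ 1 + ε - smoothIndicator P m (fun i => X ω i * b j) := fun ω j => by
    have := smoothIndicator_le_one hP m fun i => X ω i * b j
    linarith
  have hg0 : ∀ ω, 0 ≤ g ω := fun ω => Finset.prod_nonneg fun j _ => hfac ω j
  have hgm : Measurable g := by
    have : Continuous fun x : Fin d → ℝ =>
        ∏ j ∈ Finset.range J, (1 + ε - smoothIndicator P m (fun i => x i * b j)) := by fun_prop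
    exact this.measurable.comp hX
  have hgint : Integrable g μ := by
    refine Integrable.of_bound (C := 2 ^ J) hgm.aestronglyMeasurable
      (Filter.Eventually.of_forall fun ω => ?_)
    rw [Real.norm_eq_abs, abs_of_nonneg (hg0 ω)]
    refine (Finset.prod_le_prod (fun j _ => hfac ω j) fun j _ =>
      (?_ : _ ≤ (2 : ℝ))).trans_eq (by simp)
    have := smoothIndicator_nonneg P m fun i => X ω i * b j
    linarith
  have hmarkov : μ.real (missEvent X b J P m ε) ≤ ∫ ω, g ω ∂μ := by
    have h1 := mul_meas_ge_le_integral_of_nonneg (Filter.Eventually.of_forall hg0) hgint 1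
    rw [one_mul] at h1
    refine le_trans (measureReal_mono fun ω hω => ?_) h1
    show (1 : ℝ) ≤ g ω
    refine Finset.one_le_prod fun j hj => ?_
    have := hω j (Finset.mem_range.1 hj)
    linarith
  refine hmarkov.trans ((Real.le_norm_self _).trans (hmain.trans ?_))
  rw [hc0norm]
  gcongr
  · rw [← hc0norm]; exact norm_nonneg _
  · have := Real.add_one_le_exp (-(v - ε))
    linarith

end Probability

/-! ### Union bound and Borel–Cantelli. -/

section Hitting

variable {Ω : Type*} {d : ℕ} {X : Ω → Fin d → ℝ}

/-- The indices of slab sets whose coefficients are at most `H`. -/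
def slabIndex (d H : ℕ) : Finset ((Fin d → Fin d → ℤ) × (Fin d → ℤ)) :=
  (Fintype.piFinset fun _ => freqBox d H) ×ˢ freqBox d H

lemma card_slabIndex (d H : ℕ) : (slabIndex d H).card = (2 * H + 1) ^ (d * d + d) := by
  rw [slabIndex, Finset.card_product, Fintype.card_piFinset_const, card_freqBox, ← pow_mul, pow_add]

open Classical in
/-- At scale `N`, some slab set of volume at least `v` is missed by the dilates `b j • X`. -/
def badEvent (X : Ω → Fin d → ℝ) (b : ℕ → ℤ) (J N : ℕ) (v : ℝ) : Set Ω :=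
  ⋃ q ∈ (slabIndex d (N ^ 4)).filter fun q => v ≤ volume.real (slabSet N q.1 q.2),
    missEvent X b J (slabSet N q.1 q.2) (N ^ 7) (1 / (N : ℝ) ^ 2)

/-- Outside the bad event every large convex body is hit. -/
lemma exists_fract_mem_of_notMem_badEvent (hd : 1 ≤ d) {r Υ C : ℝ} {a : ℕ → ℤ} {N s J : ℕ} {R : ℝ}
    (h : ScaleParams d r Υ C N s J R) {ω : Ω}
    (hω : ω ∉ badEvent X (fun j => a (1 + s * (j + 1))) J N
      ((1 / (16 * d : ℝ)) ^ d * (C * Real.log N ^ 2 / N)))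
    {K : Set (Fin d → ℝ)} (hK : IsCompact K) (hKc : Convex ℝ K) (hKcube : K ⊆ piCube d)
    (hvol : C * Real.log N ^ 2 / N ≤ volume.real K) :
    ∃ n, 1 ≤ n ∧ n ≤ N ∧ (fun i => Int.fract (X ω i * a n)) ∈ K := by
  classical
  have hN : (5 : ℝ) ≤ N := by exact_mod_cast h.five_le
  have hN1 : 1 ≤ N := by have := h.five_le; omega
  obtain ⟨B, β, hB, hβ, hv, hroom⟩ := exists_slabSet hd h.le_one h.le_two hK hKc hKcube
    (le_trans (div_le_div_of_nonneg_right h.log_le (by linarith)) hvol)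
  by_contra! hcon
  refine hω (Set.mem_biUnion (x := (B, β)) ?_ ?_)
  · refine Finset.mem_coe.2 (Finset.mem_filter.2 ⟨?_, ?_⟩)
    · simp only [slabIndex, Finset.mem_product, Fintype.mem_piFinset, mem_freqBox]
      exact ⟨hB, hβ⟩
    · exact (mul_le_mul_of_nonneg_left hvol (by positivity)).trans hv
  · intro j hj
    have hn : 1 + s * (j + 1) ≤ N := by
      have h1 := h.index_le
      have h2 : s * (j + 1) ≤ s * J := Nat.mul_le_mul_left s hj
      omega
    have hmiss := hcon _ (by omega) hn
    have hper := smoothIndicator_add_int (slabSet N B β) (N ^ 7)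
      (fun i => Int.fract (X ω i * a (1 + s * (j + 1)))) fun i => ⌊X ω i * a (1 + s * (j + 1))⌋
    simp only [Int.fract_add_floor] at hper
    rw [hper]
    exact (smoothIndicator_le_of_notMem (slabSet_subset N B β) hKcube (by positivity) hroom
      (Nat.one_le_pow _ _ hN1) ⟨fun i => Int.fract_nonneg _, fun i => (Int.fract_lt_one _).le⟩
      hmiss).trans h.tail_le

variable [MeasurableSpace Ω] {μ : Measure Ω} [IsProbabilityMeasure μ]

lemma measure_badEvent_le (hX : Measurable X) {A Υ : ℝ} (hA : 0 ≤ A) (hΥ : 0 < Υ)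
    (hdec : HasIntFourierDecay μ X A Υ) {r C : ℝ} (hr : 1 < r) {a : ℕ → ℤ} (ha : IsLacunary r a)
    {N s J : ℕ} {R : ℝ} (h : ScaleParams d r Υ C N s J R) :
    μ.real (badEvent X (fun j => a (1 + s * (j + 1))) J N
      ((1 / (16 * d : ℝ)) ^ d * (C * Real.log N ^ 2 / N))) ≤
      (1 + 2 ^ (1 + Υ) * A) * (1 / (N : ℝ) ^ 2) := by
  classical
  have hN : (5 : ℝ) ≤ N := by exact_mod_cast h.five_le
  have hN1 : 1 ≤ N := by have := h.five_le; omega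
  have hrs : 0 ≤ r ^ s := by positivity
  -- Starting at index `1 + s` rather than 1 makes even the first dilate at least `r ^ s ≥ R`.
  have hb0 : R ≤ (a (1 + s * (0 + 1)) : ℝ) := by
    have h1 := ha.pow_mul_le (by linarith) le_rfl s
    have h2 : (1 : ℝ) ≤ a 1 := by exact_mod_cast ha.pos 1 le_rfl
    rw [zero_add, mul_one]
    exact (h.ratio_le.trans (le_mul_of_one_le_right hrs h2)).trans h1
  have hb : ∀ j, R * (a (1 + s * (j + 1)) : ℝ) ≤ a (1 + s * (j + 1 + 1)) := by
    intro j
    have h1 := ha.pow_mul_le (by linarith) (show 1 ≤ 1 + s * (j + 1) by omega) s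
    have h2 : (0 : ℝ) < a (1 + s * (j + 1)) := by exact_mod_cast ha.pos _ (by omega)
    rw [show 1 + s * (j + 1 + 1) = 1 + s * (j + 1) + s by ring]
    exact (mul_le_mul_of_nonneg_right h.ratio_le h2.le).trans h1
  set v := (1 / (16 * d : ℝ)) ^ d * (C * Real.log N ^ 2 / N)
  set E := 1 / (N : ℝ) ^ unionExponent d with hE
  have hE2 : E ≤ 1 / 2 := by
    rw [hE]
    refine one_div_le_one_div_of_le (by norm_num) ?_
    exact (by linarith : (2 : ℝ) ≤ N).trans
      (le_self_pow₀ (by linarith) (by simp [unionExponent]))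
  have hε1 : 1 / (N : ℝ) ^ 2 ≤ 1 := by
    rw [div_le_one (by positivity)]; exact one_le_pow₀ (by linarith)
  have hone : ∀ q ∈ (slabIndex d (N ^ 4)).filter fun q => v ≤ volume.real (slabSet N q.1 q.2),
      μ.real (missEvent X (fun j => a (1 + s * (j + 1))) J (slabSet N q.1 q.2) (N ^ 7)
        (1 / (N : ℝ) ^ 2)) ≤ (1 + 2 ^ (1 + Υ) * A) * E := by
    intro q hq
    refine (measure_missEvent_le hX hA hΥ hdec (Nat.one_le_pow _ _ hN1) h.le_ratio hb0 hb
      (slabSet_subset N q.1 q.2) (by positivity) hε1 h.le_volume (Finset.mem_filter.1 hq).2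
      (h.error_le.trans hE2) J).trans ?_
    rw [add_mul 1, one_mul]
    refine add_le_add h.pow_le (mul_le_mul_of_nonneg_left h.error_le (by positivity))
  refine (measureReal_biUnion_finset_le _ _).trans ((Finset.sum_le_sum hone).trans ?_)
  rw [Finset.sum_const, nsmul_eq_mul]
  have hcard : (((slabIndex d (N ^ 4)).filter fun q => v ≤ volume.real (slabSet N q.1 q.2)).card : ℝ) ≤
      (2 * (N : ℝ) ^ 4 + 1) ^ (d * d + d) := by
    have := Finset.card_filter_le (slabIndex d (N ^ 4)) fun q => v ≤ volume.real (slabSet N q.1 q.2)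
    rw [card_slabIndex] at this
    exact_mod_cast this
  calc _ ≤ (2 * (N : ℝ) ^ 4 + 1) ^ (d * d + d) * ((1 + 2 ^ (1 + Υ) * A) * E) := by gcongr
    _ = (1 + 2 ^ (1 + Υ) * A) * ((2 * (N : ℝ) ^ 4 + 1) ^ (d * d + d) * E) := by ring
    _ ≤ _ := mul_le_mul_of_nonneg_left (card_mul_le h.five_le d) (by positivity)

/-- Almost surely, the lacunary dilates of `X` hit all large convex bodies. -/
theorem ae_eventually_hits (hd : 1 ≤ d) (hX : Measurable X) {A Υ : ℝ} (hA : 0 ≤ A) (hΥ : 0 < Υ)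
    (hdec : HasIntFourierDecay μ X A Υ) {r C : ℝ} (hr : 1 < r)
    (hC : ∀ᶠ N : ℕ in Filter.atTop, ∃ s J : ℕ, ∃ R : ℝ, ScaleParams d r Υ C N s J R)
    {a : ℕ → ℤ} (ha : IsLacunary r a) :
    ∀ᵐ ω ∂μ, ∃ N₀ : ℕ, ∀ N : ℕ, N₀ ≤ N → ∀ K : Set (Fin d → ℝ), IsCompact K → Convex ℝ K →
      K ⊆ piCube d → C * Real.log N ^ 2 / N ≤ volume.real K →
      ∃ n, 1 ≤ n ∧ n ≤ N ∧ (fun i => Int.fract (X ω i * a n)) ∈ K := by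
  obtain ⟨N₁, hN₁⟩ := Filter.eventually_atTop.1 hC
  have hC' : ∀ i : ℕ, ∃ s J : ℕ, ∃ R : ℝ, ScaleParams d r Υ C (i + N₁) s J R :=
    fun i => hN₁ _ (by omega)
  choose s J R hp using hC'
  set S : ℕ → Set Ω := fun i => badEvent X (fun j => a (1 + s i * (j + 1))) (J i) (i + N₁)
    ((1 / (16 * d : ℝ)) ^ d * (C * Real.log (i + N₁ : ℕ) ^ 2 / (i + N₁ : ℕ)))
  have hsummable : Summable fun i : ℕ =>
      (1 + 2 ^ (1 + Υ) * A) * (1 / ((i + N₁ : ℕ) : ℝ) ^ 2) := by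
    refine Summable.mul_left _ ?_
    exact (summable_nat_add_iff N₁ (f := fun n : ℕ => 1 / (n : ℝ) ^ 2)).2
      (Real.summable_one_div_nat_pow.2 one_lt_two)
  have hsum : ∑' i, μ (S i) ≠ ⊤ := by
    refine ne_top_of_le_ne_top hsummable.tsum_ofReal_ne_top (ENNReal.tsum_le_tsum fun i => ?_)
    rw [← ofReal_measureReal]
    exact ENNReal.ofReal_le_ofReal (measure_badEvent_le hX hA hΥ hdec hr ha (hp i))
  filter_upwards [ae_eventually_notMem hsum] with ω hω
  obtain ⟨i₀, hi₀⟩ := Filter.eventually_atTop.1 hω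
  refine ⟨i₀ + N₁, fun N hN K hK hKc hKcube hvol => ?_⟩
  obtain ⟨i, rfl⟩ : ∃ i, N = i + N₁ := ⟨N - N₁, by omega⟩
  exact exists_fract_mem_of_notMem_badEvent hd (hp i) (hi₀ i (by omega)) hK hKc hKcube hvol

end Hitting

/-! ### Transfer to Euclidean space, and Lebesgue measure. -/

section Euclidean

variable {d : ℕ}

lemma hasIntFourierDecay_of_hasFourierDecay {μ : Measure (EuclideanSpace ℝ (Fin d))}
    [IsProbabilityMeasure μ] {Υ : ℝ} (hΥ : 0 < Υ) (h : HasFourierDecay μ Υ) :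
    ∃ A : ℝ, 0 ≤ A ∧ HasIntFourierDecay μ (fun α => WithLp.ofLp α) A Υ := by
  obtain ⟨A, hA⟩ := h
  have hA0 : 0 ≤ A := by simpa using (norm_nonneg _).trans (hA 0)
  refine ⟨A, hA0, fun k T hT ⟨i, hi⟩ => ?_⟩
  set x : EuclideanSpace ℝ (Fin d) := WithLp.toLp 2 fun i => (k i : ℝ)
  have h1 : ∫ α, expUnit (phase k (WithLp.ofLp α)) ∂μ = measureFourier μ x := by
    unfold measureFourier
    refine integral_congr_ae (Filter.Eventually.of_forall fun α => ?_)
    have h2 : inner ℝ x α = phase k (WithLp.ofLp α) := by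
      simp [PiLp.inner_apply, phase, x, mul_comm]
    simp only [h2, expUnit]
  rw [h1]
  refine (hA x).trans (mul_le_mul_of_nonneg_left ?_ hA0)
  have h3 : T ≤ ‖x‖ := hi.trans (PiLp.norm_apply_le x i)
  exact Real.rpow_le_rpow_of_nonpos (by linarith) (by linarith) (by linarith)

lemma preimage_toLp_unitCube :
    (WithLp.toLp 2 : (Fin d → ℝ) → EuclideanSpace ℝ (Fin d)) ⁻¹' unitCube d = piCube d := by
  ext x
  simp [unitCube, piCube, Set.mem_Icc, Pi.le_def, forall_and]

lemma measurableSet_unitCube : MeasurableSet (unitCube d) := by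
  have : unitCube d = ⋂ i, (fun x : EuclideanSpace ℝ (Fin d) => x i) ⁻¹' Set.Icc 0 1 := by
    ext x; simp [unitCube]
  rw [this]
  exact MeasurableSet.iInter fun i => (by fun_prop : Measurable _) measurableSet_Icc

lemma volume_unitCube : volume (unitCube d) = 1 := by
  rw [← (PiLp.volume_preserving_toLp (Fin d)).measure_preimage
    measurableSet_unitCube.nullMeasurableSet, preimage_toLp_unitCube, volume_piCube]

/-- Nonzero integer frequencies integrate to 0 over the cube; if `k i = 0` then `T = 0` and the
trivial bound 1 suffices. Hence every exponent is allowed. -/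
lemma hasIntFourierDecay_volume (Υ : ℝ) :
    HasIntFourierDecay (volume.restrict (unitCube d)) (fun α => WithLp.ofLp α) 1 Υ := by
  rintro k T hT ⟨i, hi⟩
  have h1 : ∫ α in unitCube d, expUnit (phase k (WithLp.ofLp α)) =
      ∫ y in piCube d, expUnit (phase k y) := by
    rw [← preimage_toLp_unitCube, ← (PiLp.volume_preserving_toLp (Fin d)).setIntegral_preimage_emb
      (MeasurableEquiv.toLp 2 (Fin d → ℝ)).measurableEmbedding]
  have h2 : ∀ y : Fin d → ℝ, expUnit (phase k y) = ∏ i, expUnit (-((-k i : ℤ) * y i)) := by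
    intro y
    rw [phase, expUnit_sum]
    refine Finset.prod_congr rfl fun i _ => ?_
    congr 1; push_cast; ring
  rw [h1]
  simp_rw [h2]
  rw [setIntegral_piCube_prod fun i t => expUnit (-((-k i : ℤ) * t))]
  simp_rw [integral_expUnit_int]
  by_cases hki : k i = 0
  · have hT0 : T = 0 := le_antisymm (by simpa [hki] using hi) hT
    rw [hT0, add_zero, Real.one_rpow, mul_one, norm_prod]
    refine Finset.prod_le_one (fun _ _ => norm_nonneg _) fun j _ => ?_
    split_ifs <;> simp
  · rw [Finset.prod_eq_zero (Finset.mem_univ i) (by simp [hki]), norm_zero]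
    positivity

lemma eventuallyHitsConvexBodies_of_pi {C : ℝ} {a : ℕ → ℤ} {α : EuclideanSpace ℝ (Fin d)}
    (h : ∃ N₀ : ℕ, ∀ N : ℕ, N₀ ≤ N → ∀ K : Set (Fin d → ℝ), IsCompact K → Convex ℝ K →
      K ⊆ piCube d → C * Real.log N ^ 2 / N ≤ volume.real K →
      ∃ n, 1 ≤ n ∧ n ≤ N ∧ (fun i => Int.fract (WithLp.ofLp α i * a n)) ∈ K) :
    EventuallyHitsConvexBodies C a α := by
  obtain ⟨N₀, h⟩ := h
  refine ⟨N₀, fun N hN K hK hvol => ?_⟩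
  set e := (EuclideanSpace.equiv (Fin d) ℝ).symm
  have hpre : (WithLp.toLp 2 : (Fin d → ℝ) → EuclideanSpace ℝ (Fin d)) = e := rfl
  refine h N hN ((WithLp.toLp 2) ⁻¹' (K : Set (EuclideanSpace ℝ (Fin d)))) ?_ ?_ ?_ ?_
  · rw [hpre]
    exact e.toHomeomorph.isClosedEmbedding.isCompact_preimage K.isCompact
  · rw [hpre]
    exact K.convex.linear_preimage (e : (Fin d → ℝ) →ₗ[ℝ] EuclideanSpace ℝ (Fin d))
  · rw [← preimage_toLp_unitCube]; exact Set.preimage_mono hK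
  · rwa [measureReal_def, (PiLp.volume_preserving_toLp (Fin d)).measure_preimage
      K.isCompact.measurableSet.nullMeasurableSet]

end Euclidean

end

theorem theorem2p1 (d : ℕ) (hd : 1 ≤ d) (r : ℝ) (hr : 1 < r) :
    (∀ Υ : ℝ, 0 < Υ → ∃ C : ℝ, 0 < C ∧
      ∀ a : ℕ → ℤ, IsLacunary r a →
      ∀ μ : Measure (EuclideanSpace ℝ (Fin d)), IsProbabilityMeasure μ →
        μ (unitCube d)ᶜ = 0 → HasFourierDecay μ Υ →
        ∀ᵐ α ∂μ, EventuallyHitsConvexBodies C a α) ∧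
    (∃ C : ℝ, 0 < C ∧
      ∀ a : ℕ → ℤ, IsLacunary r a →
        ∀ᵐ α ∂(volume.restrict (unitCube d)), EventuallyHitsConvexBodies C a α) := by
  have hX : Measurable fun α : EuclideanSpace ℝ (Fin d) => WithLp.ofLp α := by fun_prop
  constructor
  · intro Υ hΥ
    obtain ⟨C, hC, hparams⟩ := exists_scaleParams hd hr hΥ
    refine ⟨C, hC, fun a ha μ _ _ hμ => ?_⟩
    obtain ⟨A, hA, hdec⟩ := hasIntFourierDecay_of_hasFourierDecay hΥ hμ
    filter_upwards [ae_eventually_hits hd hX hA hΥ hdec hr hparams ha] with α hα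
    exact eventuallyHitsConvexBodies_of_pi hα
  -- Fixing the exponent 1 leaves `C` depending on `d` and `r` only.
  · obtain ⟨C, hC, hparams⟩ := exists_scaleParams hd hr one_pos
    refine ⟨C, hC, fun a ha => ?_⟩
    have : IsProbabilityMeasure (volume.restrict (unitCube d)) :=
      ⟨by rw [Measure.restrict_apply_univ, volume_unitCube]⟩
    filter_upwards [ae_eventually_hits hd hX zero_le_one one_pos (hasIntFourierDecay_volume 1) hr
      hparams ha] with α hα
    exact eventuallyHitsConvexBodies_of_pi hα
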